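/- Work on the real RAM: memory cells hold natural numbers or real numbers, indirect addressing is allowed, and addition and (truncated) subtraction of natural numbers, the four arithmetic operations on real numbers, comparisons and memory accesses each take one unit of time (there is no rounding of real numbers). A unit disk is a closed disk of radius $1$ in the Euclidean plane. In the $k$-colorable discrete unit disk cover problem ($k$-CDUDC) one is given a set $P$ of $n\ge 1$ points and a set $D$ of $m$ unit disks in the plane and an integer $k\ge 1$, such that $D$ contains a $k$-colorable cover of $P$. Here a $k$-colorable cover of $P$ is a subset $D'\subseteq D$ such that every point of $P$ lies in a disk of $D'$ and there is a map $\chi:D'\to\{1,\dots,k\}$ with $\chi(d)\neq\chi(d')$ for all distinct $d,d'\in D'$ with $d\cap d'\neq\emptyset$. A $4$-approximation algorithm computes, from $P$, $D$ and $k$, a set $D'\subseteq D$ that covers $P$ together with a map $\chi:D'\to\{1,\dots,4k\}$ such that $\chi(d)\ne\chi(d')$ for all distinct $d,d'\in D'$ with $d\cap d'\neq\emptyset$. Theorem. There is a $4$-approximation algorithm for $k$-CDUDC (a single algorithm, with $k$ as part of the input) that runs in $O(m^{6k}\,n\,\log (k+1))$ time, with an absolute implied constant. Corollary. There is a $4$-approximation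 algorithm for $3$-CDUDC that runs in $O(m^{18}n)$ time. -/

import Mathlib

/-! ### The geometric problem -/

/-- The Euclidean plane. -/
abbrev Plane : Type := EuclideanSpace ℝ (Fin 2)

/-- The (closed) disk of radius `1` with centre `c`. -/
def unitDisk (c : Plane) : Set Plane := Metric.closedBall c 1

/-- `P` lists `n` points, `D` lists the centres of `m` unit disks. The disks with index in `S`
cover all the points of `P`, and `χ` colours them with colours from `{1, …, k}` in such a way that
intersecting disks receive distinct colours. -/
def IsColoredCover {n m : ℕ} (P : Fin n → Plane) (D : Fin m → Plane) (k : ℕ)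
    (S : Finset (Fin m)) (χ : Fin m → ℕ) : Prop :=
  (∀ p : Fin n, ∃ d ∈ S, P p ∈ unitDisk (D d)) ∧
  (∀ d ∈ S, χ d ∈ Finset.Icc 1 k) ∧
  (∀ d ∈ S, ∀ d' ∈ S, d ≠ d' →
    (unitDisk (D d) ∩ unitDisk (D d')).Nonempty → χ d ≠ χ d')

/-- The disks contain a `k`-colourable cover of the points. -/
def HasColorableCover {n m : ℕ} (P : Fin n → Plane) (D : Fin m → Plane) (k : ℕ) : Prop :=
  ∃ (S : Finset (Fin m)) (χ : Fin m → ℕ), IsColoredCover P D k S χ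

/-! ### A real RAM

The memory consists of arrays of natural numbers and arrays of real numbers; array names and
indices are natural numbers, and an index may be computed (indirect addressing). A scalar variable
is a cell with a constant index. Unit-cost operations are: addition and truncated subtraction of
natural numbers, the four arithmetic operations on real numbers, comparisons, memory accesses.
There is no multiplication of natural numbers, no rounding and no conversion of real numbers into
natural numbers, and the constants of a program are natural and rational numbers. -/

namespace RealRAM

/-- A memory state: `s.int a i` and `s.real a i` are the `i`-th cells of the arrays named `a`. -/
structure Store where
  int : ℕ → ℕ → ℕ
  real : ℕ → ℕ → ℝ

/-- Expressions with values in the natural numbers. -/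
inductive IntExp where
  | const (c : ℕ)
  | get (a : ℕ) (i : IntExp)
  | add (e f : IntExp)
  | sub (e f : IntExp)

/-- Expressions with real values. -/
inductive RealExp where
  | const (q : ℚ)
  | get (a : ℕ) (i : IntExp)
  | add (e f : RealExp)
  | sub (e f : RealExp)
  | mul (e f : RealExp)
  | div (e f : RealExp)

/-- Tests. -/
inductive Test where
  | intLe (e f : IntExp)
  | realLe (e f : RealExp)
  | not (b : Test)
  | and (b c : Test)

/-- Programs. -/
inductive Program where
  | skip
  | setInt (a : ℕ) (i e : IntExp)
  | setReal (a : ℕ) (i : IntExp) (e : RealExp)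
  | seq (p q : Program)
  | ifElse (b : Test) (p q : Program)
  | loop (b : Test) (p : Program)

namespace IntExp

def eval (s : Store) : IntExp → ℕ
  | const c => c
  | get a i => s.int a (i.eval s)
  | add e f => e.eval s + f.eval s
  | sub e f => e.eval s - f.eval s

/-- The number of operations performed when the expression is evaluated. -/
def cost : IntExp → ℕ
  | const _ => 1
  | get _ i => i.cost + 1
  | add e f => e.cost + f.cost + 1
  | sub e f => e.cost + f.cost + 1

end IntExp

namespace RealExp

/-- The value of an expression; a division by zero returns `0`. -/
noncomputable def eval (s : Store) : RealExp → ℝ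
  | const q => (q : ℝ)
  | get a i => s.real a (i.eval s)
  | add e f => e.eval s + f.eval s
  | sub e f => e.eval s - f.eval s
  | mul e f => e.eval s * f.eval s
  | div e f => e.eval s / f.eval s

/-- The number of operations performed when the expression is evaluated. -/
def cost : RealExp → ℕ
  | const _ => 1
  | get _ i => i.cost + 1
  | add e f => e.cost + f.cost + 1
  | sub e f => e.cost + f.cost + 1
  | mul e f => e.cost + f.cost + 1
  | div e f => e.cost + f.cost + 1

end RealExp

namespace Test

def Holds (s : Store) : Test → Prop
  | intLe e f => e.eval s ≤ f.eval s
  | realLe e f => e.eval s ≤ f.eval s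
  | not b => ¬ b.Holds s
  | and b c => b.Holds s ∧ c.Holds s

/-- The number of operations performed when the test is evaluated. -/
def cost : Test → ℕ
  | intLe e f => e.cost + f.cost + 1
  | realLe e f => e.cost + f.cost + 1
  | not b => b.cost + 1
  | and b c => b.cost + c.cost + 1

end Test

namespace Store

def setInt (s : Store) (a i v : ℕ) : Store :=
  { s with int := Function.update s.int a (Function.update (s.int a) i v) }

noncomputable def setReal (s : Store) (a i : ℕ) (v : ℝ) : Store :=
  { s with real := Function.update s.real a (Function.update (s.real a) i v) }

end Store

/-- `Exec p s t s'`: started in the memory state `s`, the program `p` halts after exactly `t`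
operations in the memory state `s'`. -/
inductive Exec : Program → Store → ℕ → Store → Prop where
  | skip (s : Store) : Exec .skip s 1 s
  | setInt (a : ℕ) (i e : IntExp) (s : Store) :
      Exec (.setInt a i e) s (i.cost + e.cost + 1) (s.setInt a (i.eval s) (e.eval s))
  | setReal (a : ℕ) (i : IntExp) (e : RealExp) (s : Store) :
      Exec (.setReal a i e) s (i.cost + e.cost + 1) (s.setReal a (i.eval s) (e.eval s))
  | seq {p q : Program} {s s' s'' : Store} {t t' : ℕ} :
      Exec p s t s' → Exec q s' t' s'' → Exec (.seq p q) s (t + t') s''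
  | ifTrue {b : Test} {p q : Program} {s s' : Store} {t : ℕ} :
      b.Holds s → Exec p s t s' → Exec (.ifElse b p q) s (b.cost + t) s'
  | ifFalse {b : Test} {p q : Program} {s s' : Store} {t : ℕ} :
      ¬ b.Holds s → Exec q s t s' → Exec (.ifElse b p q) s (b.cost + t) s'
  | loopStop {b : Test} {p : Program} {s : Store} :
      ¬ b.Holds s → Exec (.loop b p) s b.cost s
  | loopStep {b : Test} {p : Program} {s s' s'' : Store} {t t' : ℕ} :
      b.Holds s → Exec p s t s' → Exec (.loop b p) s' t' s'' →
      Exec (.loop b p) s (b.cost + t + t') s''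

end RealRAM


/-- The memory state that holds the instance `(P, D, k)`: the first three cells of the array `0` of
natural numbers are `n`, `m`, `k`; the real arrays `0`, `1` hold the coordinates of the points, the
real arrays `2`, `3` hold the coordinates of the centres; all the other cells are `0`. -/
noncomputable def inputStore {n m : ℕ} (P : Fin n → Plane) (D : Fin m → Plane) (k : ℕ) :
    RealRAM.Store where
  int a i :=
    if a = 0 ∧ i = 0 then n else if a = 0 ∧ i = 1 then m else if a = 0 ∧ i = 2 then k else 0
  real a i :=
    if h : i < n ∧ a = 0 then P ⟨i, h.1⟩ 0
    else if h : i < n ∧ a = 1 then P ⟨i, h.1⟩ 1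
    else if h : i < m ∧ a = 2 then D ⟨i, h.1⟩ 0
    else if h : i < m ∧ a = 3 then D ⟨i, h.1⟩ 1
    else 0

/-- The output is read off from the array `1` of natural numbers: its `d`-th cell is the colour of
the `d`-th disk, and `0` if that disk is not selected. -/
def outputColor (s : RealRAM.Store) {m : ℕ} (d : Fin m) : ℕ := s.int 1 d

/-- The set of the disks that the output selects. -/
def outputDisks (s : RealRAM.Store) (m : ℕ) : Finset (Fin m) :=
  Finset.univ.filter fun d => outputColor s d ≠ 0

/-- `A` is a `ρ`-approximation algorithm, with running time at most `T n m`, for the problem with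
`k` colours: for all `n ≥ 1` points and `m` unit disks that contain a `k`-colourable cover of the
points, `A` halts after at most `T n m` operations and its output is a cover of the points by some
of the disks together with a proper colouring that uses at most `ρ * k` colours. -/
def ApproximatesWithin (A : RealRAM.Program) (ρ k : ℕ) (T : ℕ → ℕ → ℝ) : Prop :=
  ∀ (n m : ℕ) (P : Fin n → Plane) (D : Fin m → Plane),
    0 < n → HasColorableCover P D k →
    ∃ (t : ℕ) (s : RealRAM.Store),
      RealRAM.Exec A (inputStore P D k) t s ∧ (t : ℝ) ≤ T n m ∧
      IsColoredCover P D (ρ * k) (outputDisks s m) (fun d => outputColor s d)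

/-! Let `K = min k m`. Cut the plane greedily into half-open horizontal strips of height 7/5, each
beginning at the lowest point not yet covered. A disk that contains a point of the strip beginning
at `y₀` has its centre at a height in [y₀ - 1, y₀ + 12/5]. The relevant disks of a `K`-colourable
cover of all points solve the strip, so a cover of the strip by `K` packings exists
(`Cover.exists_solution`). Strips whose numbers agree mod 4 begin at least 28/5 apart, so their
relevant centres differ in height by at least 28/5 - 17/5 = 11/5 > 2. Four palettes of `K` colours
therefore suffice (`isColoredCover_of_written`).

One strip is solved exactly by a left-to-right sweep. An item is a disk with a colour, and a set of
items is extended by an item `f` that is nowhere left of its members. The conflicts of `f`, and the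
covering of points that can still be covered later, depend only on the members within horizontal
distance 2 of `f`, the window. Hence one representative set per window suffices
(`Found.exists_covering`). A window fits into four cells of size 1 × 17/10, whose squared diagonal
is 3.89 < 4. So each cell has at most one item of each colour, and there are at most (m+1)^(4K)
windows (`Found.card_le`). The height h = 7/5 is admissible because 4/3 < h ≤ 2√3 - 2: the lower
bound separates strips four apart, the upper one makes the cells small enough.

Trying all `m * K` items on a set costs O(mK(mK + n)), because flags record the covered points and a
window is looked up in constant time at the address given by its bit mask. There are at most min(n,
2m) strips (`Strips.le_n`, `Strips.le_m`). Since K ≤ m, (m+1)^(4K) ≤ e⁴ m^(4K) and (mK)² ≤ m^(2K),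
the total is O(m^(6k) n), and the factor log(k+1) is not needed (`time_le`). -/

namespace RealRAM

/-! ### Frame rule, symbolic execution and loop rules for the real RAM. -/

namespace Store

theorem setInt_int_self (s : Store) (a i v : ℕ) :
    (s.setInt a i v).int a = Function.update (s.int a) i v := by
  simp [setInt]

theorem setInt_int_of_ne (s : Store) {a b : ℕ} (i v : ℕ) (h : b ≠ a) :
    (s.setInt a i v).int b = s.int b := by
  simp [setInt, h]

theorem setInt_real (s : Store) (a i v : ℕ) : (s.setInt a i v).real = s.real := rfl

theorem setReal_int (s : Store) (a i : ℕ) (v : ℝ) : (s.setReal a i v).int = s.int := rfl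

theorem setReal_real_self (s : Store) (a i : ℕ) (v : ℝ) :
    (s.setReal a i v).real a = Function.update (s.real a) i v := by
  simp [setReal]

theorem setReal_real_of_ne (s : Store) {a b : ℕ} (i : ℕ) (v : ℝ) (h : b ≠ a) :
    (s.setReal a i v).real b = s.real b := by
  simp [setReal, h]

end Store

namespace Program

/-- Does the program contain an assignment to the array `b` of natural numbers? -/
def writesInt : Program → ℕ → Bool
  | skip, _ => false
  | setInt a _ _, b => Nat.beq a b
  | setReal _ _ _, _ => false
  | seq p q, b => p.writesInt b || q.writesInt b
  | ifElse _ p q, b => p.writesInt b || q.writesInt b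
  | loop _ p, b => p.writesInt b

/-- Does the program contain an assignment to the array `b` of real numbers? -/
def writesReal : Program → ℕ → Bool
  | skip, _ => false
  | setInt _ _ _, _ => false
  | setReal a _ _, b => Nat.beq a b
  | seq p q, b => p.writesReal b || q.writesReal b
  | ifElse _ p q, b => p.writesReal b || q.writesReal b
  | loop _ p, b => p.writesReal b

def loopFree : Program → Bool
  | skip => true
  | setInt _ _ _ => true
  | setReal _ _ _ => true
  | seq p q => p.loopFree && q.loopFree
  | ifElse _ p q => p.loopFree && q.loopFree
  | loop _ _ => false

open scoped Classical in
/-- The final memory state of a program without loops. -/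
noncomputable def run : Program → Store → Store
  | skip, s => s
  | setInt a i e, s => s.setInt a (i.eval s) (e.eval s)
  | setReal a i e, s => s.setReal a (i.eval s) (e.eval s)
  | seq p q, s => q.run (p.run s)
  | ifElse b p q, s => if b.Holds s then p.run s else q.run s
  | loop _ _, s => s

/-- An upper bound for the running time of a program without loops. -/
def maxCost : Program → ℕ
  | skip => 1
  | setInt _ i e => i.cost + e.cost + 1
  | setReal _ i e => i.cost + e.cost + 1
  | seq p q => p.maxCost + q.maxCost
  | ifElse b p q => b.cost + max p.maxCost q.maxCost
  | loop _ _ => 0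

end Program

/-- The states `s` and `s'` agree on all the arrays to which `p` does not assign. -/
structure SameOff (p : Program) (s s' : Store) : Prop where
  int : ∀ a, p.writesInt a = false → s'.int a = s.int a
  real : ∀ a, p.writesReal a = false → s'.real a = s.real a

theorem SameOff.refl (p : Program) (s : Store) : SameOff p s s := ⟨fun _ _ => rfl, fun _ _ => rfl⟩

theorem SameOff.trans {p : Program} {s s' s'' : Store} (h : SameOff p s s')
    (h' : SameOff p s' s'') : SameOff p s s'' :=
  ⟨fun a ha => (h'.int a ha).trans (h.int a ha), fun a ha => (h'.real a ha).trans (h.real a ha)⟩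

theorem SameOff.of_le {p q : Program} {s s' : Store} (h : SameOff p s s')
    (hi : ∀ a, q.writesInt a = false → p.writesInt a = false)
    (hr : ∀ a, q.writesReal a = false → p.writesReal a = false) : SameOff q s s' :=
  ⟨fun a ha => h.int a (hi a ha), fun a ha => h.real a (hr a ha)⟩

/-- Frame rule. The footprint of a program is a computable Boolean, so for a concrete program the
preservation of an array is proved by `rfl`; all later invariants mention only what changes. -/
theorem Exec.sameOff {p : Program} {s s' : Store} {t : ℕ} (h : Exec p s t s') :
    SameOff p s s' := by
  induction h with
  | skip s => exact SameOff.refl _ _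
  | setInt a i e s =>
    refine ⟨fun b hb => s.setInt_int_of_ne _ _ ?_, fun b _ => rfl⟩
    rintro rfl
    simp [Program.writesInt] at hb
  | setReal a i e s =>
    refine ⟨fun b _ => rfl, fun b hb => s.setReal_real_of_ne _ _ ?_⟩
    rintro rfl
    simp [Program.writesReal] at hb
  | seq _ _ ih ih' =>
    exact (ih.of_le (by simp +contextual [Program.writesInt])
      (by simp +contextual [Program.writesReal])).trans
      (ih'.of_le (by simp +contextual [Program.writesInt])
      (by simp +contextual [Program.writesReal]))
  | ifTrue _ _ ih =>
    exact ih.of_le (by simp +contextual [Program.writesInt])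
      (by simp +contextual [Program.writesReal])
  | ifFalse _ _ ih =>
    exact ih.of_le (by simp +contextual [Program.writesInt])
      (by simp +contextual [Program.writesReal])
  | loopStop _ => exact SameOff.refl _ _
  | loopStep _ _ _ ih ih' =>
    exact (ih.of_le (by simp +contextual [Program.writesInt])
      (by simp +contextual [Program.writesReal])).trans ih'

/-- Started in `s`, the program `p` halts after at most `T` operations in a state that
satisfies `Q`. -/
def Runs (p : Program) (s : Store) (T : ℕ) (Q : Store → Prop) : Prop :=
  ∃ t s', Exec p s t s' ∧ t ≤ T ∧ Q s'

namespace Runs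

variable {p q : Program} {s : Store} {T T' : ℕ} {Q Q' : Store → Prop}

theorem mono (h : Runs p s T Q) (hT : T ≤ T') (hQ : ∀ s', SameOff p s s' → Q s' → Q' s') :
    Runs p s T' Q' := by
  obtain ⟨t, s', he, ht, hq⟩ := h
  exact ⟨t, s', he, ht.trans hT, hQ s' he.sameOff hq⟩

theorem seq (h : Runs p s T fun s' => Runs q s' T' Q) : Runs (.seq p q) s (T + T') Q := by
  obtain ⟨t, s', he, ht, t', s'', he', ht', hq⟩ := h
  exact ⟨_, s'', he.seq he', by omega, hq⟩

theorem seq_of (h : Runs p s T Q') (hq : ∀ s', SameOff p s s' → Q' s' → Runs q s' T' Q) :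
    Runs (.seq p q) s (T + T') Q :=
  seq (h.mono le_rfl hq)

theorem of_loopFree (h : p.loopFree = true) (s : Store) :
    Runs p s p.maxCost fun s' => s' = p.run s := by
  induction p generalizing s with
  | skip => exact ⟨_, _, .skip s, le_rfl, rfl⟩
  | setInt a i e => exact ⟨_, _, .setInt a i e s, le_rfl, rfl⟩
  | setReal a i e => exact ⟨_, _, .setReal a i e s, le_rfl, rfl⟩
  | seq p q ihp ihq =>
    simp only [Program.loopFree, Bool.and_eq_true] at h
    refine seq_of (ihp h.1 s) fun s' _ hs' => ?_
    subst hs'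
    exact ihq h.2 _
  | ifElse b p q ihp ihq =>
    simp only [Program.loopFree, Bool.and_eq_true] at h
    by_cases hb : b.Holds s
    · obtain ⟨t, s', he, ht, rfl⟩ := ihp h.1 s
      refine ⟨_, _, .ifTrue hb he, ?_, by simp [Program.run, hb]⟩
      simp only [Program.maxCost]
      omega
    · obtain ⟨t, s', he, ht, rfl⟩ := ihq h.2 s
      refine ⟨_, _, .ifFalse hb he, ?_, by simp [Program.run, hb]⟩
      simp only [Program.maxCost]
      omega
  | loop b p => simp [Program.loopFree] at h

/-- Reduces straight-line code to a numerical bound, checked by evaluation, and to a statement about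
the function `run`, which `simp` computes. -/
theorem run_of (h : p.loopFree = true) (hT : p.maxCost ≤ T) (hQ : Q (p.run s)) : Runs p s T Q :=
  (of_loopFree h s).mono hT fun _ _ hs => hs ▸ hQ

/-- A loop with an invariant that counts the iterations. -/
theorem loop {b : Test} {s₀ : Store} (I : ℕ → Store → Prop) (N T : ℕ) (h₀ : I 0 s₀)
    (hstep : ∀ j s, SameOff p s₀ s → I j s → b.Holds s → j < N ∧ Runs p s T (I (j + 1))) :
    Runs (.loop b p) s₀ (N * (b.cost + T) + b.cost) fun s' => ∃ j, I j s' ∧ ¬ b.Holds s' := by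
  suffices H : ∀ r j s, SameOff p s₀ s → I j s → N - j = r →
      Runs (.loop b p) s (r * (b.cost + T) + b.cost) fun s' => ∃ j, I j s' ∧ ¬ b.Holds s' from
    H N 0 s₀ (SameOff.refl _ _) h₀ rfl
  intro r
  induction r with
  | zero =>
    intro j s hs hI hr
    by_cases hb : b.Holds s
    · have := (hstep j s hs hI hb).1
      omega
    · exact ⟨_, _, .loopStop hb, by omega, j, hI, hb⟩
  | succ r ih =>
    intro j s hs hI hr
    by_cases hb : b.Holds s
    · obtain ⟨t, s', he, ht, hI'⟩ := (hstep j s hs hI hb).2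
      obtain ⟨t', s'', he', ht', hq⟩ := ih (j + 1) s' (hs.trans he.sameOff) hI' (by omega)
      refine ⟨_, _, .loopStep hb he he', ?_, hq⟩
      rw [Nat.succ_mul]
      omega
    · exact ⟨_, _, .loopStop hb, by omega, j, hI, hb⟩

end Runs

/-- A scalar variable. -/
abbrev IntExp.var (a : ℕ) : IntExp := .get a (.const 0)

/-- The assignment of a value to a scalar variable. -/
abbrev Program.setVar (a : ℕ) (e : IntExp) : Program := .setInt a (.const 0) e

/-- For `v = 0, 1, …`, as long as `v` is less than the value of `b`, execute `p`. -/
abbrev Program.forLoop (v : ℕ) (b : IntExp) (p : Program) : Program :=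
  .seq (.setVar v (.const 0))
    (.loop (.not (.intLe b (.var v))) (.seq p (.setVar v (.add (.var v) (.const 1)))))

/-- The invariant is required after the counter has been incremented, while `hv` keeps the body from
changing the counter. The bound `b` is reevaluated in every round, so its value must survive the
whole loop. -/
theorem Runs.forLoop {p : Program} {v : ℕ} {b : IntExp} {s₀ : Store} (N T : ℕ)
    (I : ℕ → Store → Prop)
    (hb : ∀ s, SameOff (.forLoop v b p) s₀ s → b.eval s = N)
    (hv : p.writesInt v = false)
    (h₀ : I 0 (s₀.setInt v 0 0))
    (hstep : ∀ i s, i < N → SameOff (.forLoop v b p) s₀ s → s.int v 0 = i → I i s →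
      Runs p s T fun s' => I (i + 1) (s'.setInt v 0 (i + 1))) :
    Runs (.forLoop v b p) s₀ (N * (T + b.cost + 10) + b.cost + 10) (I N) := by
  have hsub : SameOff (.forLoop v b p) s₀ (s₀.setInt v 0 0) :=
    (Exec.setInt v (.const 0) (.const 0) s₀).sameOff.of_le
      (by simp +contextual [Program.writesInt]) (by simp +contextual [Program.writesReal])
  have hset : Runs (.setVar v (.const 0)) s₀ 3 fun s => s = s₀.setInt v 0 0 :=
    Runs.of_loopFree rfl s₀
  -- The test costs `b.cost + 4` and the increment of the counter costs 6.
  refine (Runs.seq_of (T' := N * (b.cost + 4 + (T + 6)) + (b.cost + 4)) hset ?_).mono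
    (Q := I N) (by nlinarith) fun _ _ h => h
  rintro _ _ rfl
  refine (Runs.loop (fun j s => I j s ∧ s.int v 0 = j ∧ j ≤ N) N (T + 6) ?_ ?_).mono ?_ ?_
  · exact ⟨h₀, by simp [Store.setInt_int_self], Nat.zero_le _⟩
  · rintro j s hs ⟨hI, hj, -⟩ hh
    have hs' : SameOff (.forLoop v b p) s₀ s := hsub.trans (hs.of_le
      (by simp +contextual [Program.writesInt]) (by simp +contextual [Program.writesReal]))
    have hjN : j < N := by
      simpa [Test.Holds, IntExp.eval, hb s hs', hj] using hh
    refine ⟨hjN, Runs.seq_of (hstep j s hjN hs' hj hI) fun s' hss' hI' => ?_⟩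
    refine Runs.run_of rfl (by simp [Program.maxCost, IntExp.cost]) ?_
    have : s'.int v 0 = j := by rw [hss'.int v hv, hj]
    simpa [Program.run, IntExp.eval, this, Store.setInt_int_self] using ⟨hI', hjN⟩
  · simp only [Test.cost, IntExp.cost]
    nlinarith
  · rintro s hs ⟨j, ⟨hI, hj, hjN⟩, hh⟩
    have hs' : SameOff (.forLoop v b p) s₀ s := hsub.trans (hs.of_le
      (by simp +contextual [Program.writesInt]) (by simp +contextual [Program.writesReal]))
    have : N ≤ j := by
      simpa [Test.Holds, IntExp.eval, hb s hs', hj] using hh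
    rwa [le_antisymm this hjN]

end RealRAM

/-! ### Sweeping a single strip. -/

/-- The task of covering the points `p < n` that satisfy `need p`, all of them in a horizontal strip
that begins at the height `y₀`, by `K` packings of unit disks taken from `m` given ones. An item is a
pair of a disk and a colour; the `e`-th of the `m * K` items is the disk `e % m` with the colour
`e / m`. -/
structure StripTask where
  n : ℕ
  m : ℕ
  K : ℕ
  px : ℕ → ℝ
  py : ℕ → ℝ
  dx : ℕ → ℝ
  dy : ℕ → ℝ
  y₀ : ℝ
  need : ℕ → Prop

namespace StripTask

variable (S : StripTask)

def x (e : ℕ) : ℝ := S.dx (e % S.m)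

def y (e : ℕ) : ℝ := S.dy (e % S.m)

/-- The items have the same colour and their disks intersect. -/
def Conflict (e f : ℕ) : Prop :=
  e / S.m = f / S.m ∧ (S.x e - S.x f) * (S.x e - S.x f) + (S.y e - S.y f) * (S.y e - S.y f) ≤ 4

/-- The disk of the item `e` contains the point `p`. -/
def Covers (e p : ℕ) : Prop :=
  (S.px p - S.x e) * (S.px p - S.x e) + (S.py p - S.y e) * (S.py p - S.y e) ≤ 1

/-- The disk of the item is close enough to the strip to contain points of it. -/
def Relevant (e : ℕ) : Prop := S.y₀ - 1 ≤ S.y e ∧ S.y e ≤ S.y₀ + 12 / 5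

def CoveredBy (A : Finset ℕ) (p : ℕ) : Prop := S.need p → ∃ e ∈ A, S.Covers e p

/-- A set of relevant items without conflicts. -/
structure Independent (A : Finset ℕ) : Prop where
  lt : ∀ e ∈ A, e < S.m * S.K
  relevant : ∀ e ∈ A, S.Relevant e
  not_conflict : ∀ e ∈ A, ∀ f ∈ A, e ≠ f → ¬ S.Conflict e f

/-- A set that solves the task. -/
structure Solution (A : Finset ℕ) : Prop extends S.Independent A where
  covered : ∀ p < S.n, S.CoveredBy A p

/-- The search adds the item `f` to the set `A`. -/
structure Extends (A : Finset ℕ) (f : ℕ) : Prop where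
  relevant : S.Relevant f
  le : ∀ e ∈ A, S.x e ≤ S.x f
  not_conflict : ∀ e ∈ A, ¬ S.Conflict e f
  covered : ∀ p < S.n, S.px p < S.x f - 1 → S.CoveredBy A p

open scoped Classical in
/-- The members of `A` that are relevant for the continuation of the search after `f`. -/
noncomputable def window (A : Finset ℕ) (f : ℕ) : Finset ℕ := A.filter fun e => S.x f - 2 ≤ S.x e

variable {S}

theorem mem_window {A : Finset ℕ} {e f : ℕ} : e ∈ S.window A f ↔ e ∈ A ∧ S.x f - 2 ≤ S.x e := by
  simp [window]

theorem conflict_self (e : ℕ) : S.Conflict e e := by simp [Conflict]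

theorem Conflict.symm {e f : ℕ} (h : S.Conflict e f) : S.Conflict f e :=
  ⟨h.1.symm, by linarith [h.2]⟩

theorem Extends.notMem {A : Finset ℕ} {f : ℕ} (h : S.Extends A f) : f ∉ A :=
  fun hf => h.not_conflict f hf (conflict_self f)

theorem Independent.insert {A : Finset ℕ} {f : ℕ} (hA : S.Independent A) (hf : f < S.m * S.K)
    (h : S.Extends A f) : S.Independent (insert f A) := by
  refine ⟨?_, ?_, ?_⟩
  · simpa using ⟨hf, hA.lt⟩
  · simpa using ⟨h.relevant, hA.relevant⟩
  · intro a ha b hb hab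
    rcases Finset.mem_insert.1 ha with rfl | ha' <;>
      rcases Finset.mem_insert.1 hb with rfl | hb'
    · exact absurd rfl hab
    · exact fun hc => h.not_conflict b hb' hc.symm
    · exact h.not_conflict a ha'
    · exact hA.not_conflict a ha' b hb' hab

/-- Drop the vertical term. Together with the next two bounds this explains the width 2 of the
window: a conflict reaches back by 2, and a point not left of `x f - 1` is covered only by disks
with abscissa at least `x f - 2`. -/
theorem Conflict.le_add_two {e f : ℕ} (h : S.Conflict e f) : S.x f - 2 ≤ S.x e := by
  have := h.2
  nlinarith [mul_self_nonneg (S.y e - S.y f)]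

theorem Covers.le_add_one {e p : ℕ} (h : S.Covers e p) : S.x e ≤ S.px p + 1 := by
  unfold Covers at h
  nlinarith [mul_self_nonneg (S.py p - S.y e)]

theorem Covers.sub_one_le {e p : ℕ} (h : S.Covers e p) : S.px p - 1 ≤ S.x e := by
  unfold Covers at h
  nlinarith [mul_self_nonneg (S.py p - S.y e)]

variable (S) in
/-- The sets `A 0, …, A (t - 1)` have been found by the search, where `A q` arose by adding the
item `l q` when `q ≠ 0`. -/
structure Found (A : ℕ → Finset ℕ) (l : ℕ → ℕ) (t : ℕ) : Prop where
  pos : 0 < t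
  zero : A 0 = ∅
  independent : ∀ q < t, S.Independent (A q)
  last_mem : ∀ q < t, q ≠ 0 → l q ∈ A q
  le_last : ∀ q < t, q ≠ 0 → ∀ e ∈ A q, S.x e ≤ S.x (l q)
  covered : ∀ q < t, q ≠ 0 → ∀ p < S.n, S.px p < S.x (l q) - 1 → S.CoveredBy (A q) p
  window_inj : ∀ q < t, ∀ r < t, q ≠ 0 → r ≠ 0 → S.window (A q) (l q) = S.window (A r) (l r) →
    q = r

/-- The window of the extension of `B` by `f` is the window of one of the sets found. -/
def Represented (S : StripTask) (A : ℕ → Finset ℕ) (l : ℕ → ℕ) (t : ℕ) (B : Finset ℕ) (f : ℕ) :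
    Prop :=
  ∃ q < t, q ≠ 0 ∧ S.window (A q) (l q) = S.window (insert f B) f

/-- The position of the sweep can be read off from the window alone: each of the two last items lies
in the common window and is rightmost in its own set. -/
theorem Found.last_eq {A : ℕ → Finset ℕ} {l : ℕ → ℕ} {t : ℕ} (H : S.Found A l t)
    {q : ℕ} (hq : q < t) (hq0 : q ≠ 0) {B : Finset ℕ} {f : ℕ} (hB : ∀ e ∈ B, S.x e ≤ S.x f)
    (h : S.window (A q) (l q) = S.window (insert f B) f) : S.x (l q) = S.x f := by
  apply le_antisymm
  · have h1 : l q ∈ S.window (A q) (l q) := mem_window.2 ⟨H.last_mem q hq hq0, by linarith⟩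
    rw [h, mem_window, Finset.mem_insert] at h1
    rcases h1.1 with h2 | h2
    · rw [h2]
    · exact hB _ h2
  · have h1 : f ∈ S.window (insert f B) f := mem_window.2 ⟨Finset.mem_insert_self _ _, by linarith⟩
    rw [← h, mem_window] at h1
    exact H.le_last q hq hq0 f h1.1

theorem Found.exists_covering {A : ℕ → Finset ℕ} {l : ℕ → ℕ} {t : ℕ} (H : S.Found A l t)
    (hcl : ∀ q < t, ∀ f < S.m * S.K, S.Extends (A q) f → S.Represented A l t (A q) f)
    {F : Finset ℕ} (hF : S.Solution F) :
    ∃ q < t, ∀ p < S.n, S.CoveredBy (A q) p := by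
  have key : ∀ j ≤ F.card, ∃ G ⊆ F, G.card = j ∧ (∀ g ∈ G, ∀ f ∈ F, f ∉ G → S.x g ≤ S.x f) ∧
      ∃ q < t, ∃ T : ℝ, (∀ e ∈ A q, S.x e ≤ T) ∧ (∀ f ∈ F, f ∉ G → T ≤ S.x f) ∧
        (∀ e, T - 2 ≤ S.x e → (e ∈ A q ↔ e ∈ G)) ∧
        (∀ p < S.n, S.px p < T - 1 → S.CoveredBy (A q) p) := by
    intro j
    induction j with
    | zero =>
      intro _
      obtain ⟨T₁, hT₁⟩ := (F.image S.x).bddBelow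
      obtain ⟨T₂, hT₂⟩ := ((Finset.range S.n).image S.px).bddBelow
      -- The sweep starts to the left of all items of `F` and of all points, so nothing has to be
      -- covered yet.
      refine ⟨∅, by simp, by simp, by simp, 0, H.pos, min T₁ T₂, by simp [H.zero], ?_,
        by simp [H.zero], ?_⟩
      · intro f hf _
        exact (min_le_left _ _).trans (hT₁ (by simpa using ⟨f, hf, rfl⟩))
      · intro p hp hlt
        have : T₂ ≤ S.px p := hT₂ (by simpa using ⟨p, hp, rfl⟩)
        linarith [min_le_right T₁ T₂]
    | succ j ih =>
      intro hj
      obtain ⟨G, hGF, hGj, hG, q, hq, T, hAT, hTF, hAG, hcov⟩ := ih (by omega)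
      have hne : (F \ G).Nonempty := by
        rw [← Finset.card_pos, Finset.card_sdiff_of_subset hGF]
        omega
      obtain ⟨f, hf, hmin⟩ := Finset.exists_min_image (F \ G) S.x hne
      obtain ⟨hfF, hfG⟩ := Finset.mem_sdiff.1 hf
      have hTf := hTF f hfF hfG
      have hext : S.Extends (A q) f := by
        refine ⟨hF.relevant f hfF, fun e he => (hAT e he).trans hTf, ?_, ?_⟩
        · intro e he hc
          -- A conflict with `f` can only come from the zone where `A q` and `G` agree, and `F` has
          -- no conflicts.
          have heG : e ∈ G := (hAG e (by linarith [hc.le_add_two])).1 he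
          exact hF.not_conflict e (hGF heG) f hfF (by rintro rfl; exact hfG heG) hc
        · intro p hp hlt hneed
          by_cases hpT : S.px p < T - 1
          · exact hcov p hp hpT hneed
          · obtain ⟨g, hgF, hgp⟩ := hF.covered p hp hneed
            -- The point lies left of `x f - 1`, so its disk in `F` has its centre left of `f`, the
            -- leftmost remaining item.
            have hgG : g ∈ G := by
              by_contra hgG
              have := hmin g (Finset.mem_sdiff.2 ⟨hgF, hgG⟩)
              linarith [hgp.le_add_one]
            exact ⟨g, (hAG g (by linarith [hgp.sub_one_le])).2 hgG, hgp⟩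
      obtain ⟨r, hr, hr0, hw⟩ := hcl q hq f (hF.lt f hfF) hext
      have hlast := H.last_eq hr hr0 hext.le hw
      refine ⟨insert f G, Finset.insert_subset hfF hGF, by rw [Finset.card_insert_of_notMem hfG, hGj],
        ?_, r, hr, S.x f, ?_, ?_, ?_, ?_⟩
      · intro g hg f' hf' hf'G
        rw [Finset.mem_insert, not_or] at hf'G
        rcases Finset.mem_insert.1 hg with rfl | hg
        · exact hmin f' (Finset.mem_sdiff.2 ⟨hf', hf'G.2⟩)
        · exact hG g hg f' hf' hf'G.2
      · intro e he
        rw [← hlast]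
        exact H.le_last r hr hr0 e he
      · intro f' hf' hf'G
        rw [Finset.mem_insert, not_or] at hf'G
        exact hmin f' (Finset.mem_sdiff.2 ⟨hf', hf'G.2⟩)
      · intro e he
        have h1 : e ∈ S.window (A r) (l r) ↔ e ∈ S.window (insert f (A q)) f := by rw [hw]
        rw [mem_window, mem_window, hlast, and_iff_left he, and_iff_left he] at h1
        rw [h1, Finset.mem_insert, Finset.mem_insert, hAG e (by linarith)]
      · intro p hp hlt
        exact H.covered r hr hr0 p hp (by rwa [hlast])
  obtain ⟨G, hGF, hGc, -, q, hq, T, -, -, hAG, hcov⟩ := key _ le_rfl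
  obtain rfl := Finset.eq_of_subset_of_card_le hGF hGc.ge
  refine ⟨q, hq, fun p hp hneed => ?_⟩
  by_cases hpT : S.px p < T - 1
  · exact hcov p hp hpT hneed
  · obtain ⟨g, hg, hgp⟩ := hF.covered p hp hneed
    exact ⟨g, (hAG g (by linarith [hgp.sub_one_le])).2 hg, hgp⟩

theorem Found.single : S.Found (fun _ => ∅) (fun _ => 0) 1 := by
  constructor <;> simp +contextual
  exact ⟨by simp, by simp, by simp⟩

theorem Found.push {A : ℕ → Finset ℕ} {l : ℕ → ℕ} {t : ℕ} (H : S.Found A l t) {q f : ℕ}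
    (hq : q < t) (hf : f < S.m * S.K) (hext : S.Extends (A q) f)
    (hnew : ¬ S.Represented A l t (A q) f) :
    S.Found (Function.update A t (insert f (A q))) (Function.update l t f) (t + 1) := by
  have ht0 : t ≠ 0 := H.pos.ne'
  have hne : ∀ r, r < t → r ≠ t := fun r hr => hr.ne
  have hcase : ∀ r < t + 1, r < t ∨ r = t := fun r hr => by omega
  refine ⟨by omega, ?_, ?_, ?_, ?_, ?_, ?_⟩
  · rw [Function.update_of_ne ht0.symm, H.zero]
  · intro r hr
    rcases hcase r hr with hr | rfl
    · simpa [hne r hr] using H.independent r hr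
    · simpa using (H.independent q hq).insert hf hext
  · intro r hr hr0
    rcases hcase r hr with hr | rfl
    · simpa [hne r hr] using H.last_mem r hr hr0
    · simp
  · intro r hr hr0
    rcases hcase r hr with hr | rfl
    · simpa [hne r hr] using H.le_last r hr hr0
    · simpa using hext.le
  · intro r hr hr0
    rcases hcase r hr with hr | rfl
    · simpa [hne r hr] using H.covered r hr hr0
    · intro p hp hlt hneed
      rw [Function.update_self] at hlt ⊢
      obtain ⟨e, he, hep⟩ := hext.covered p hp hlt hneed
      exact ⟨e, Finset.mem_insert_of_mem he, hep⟩
  · intro r hr r' hr' hr0 hr0'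
    rcases hcase r hr with hr | rfl <;> rcases hcase r' hr' with hr' | rfl
    · simpa [hne r hr, hne r' hr'] using H.window_inj r hr r' hr' hr0 hr0'
    · intro h
      simp only [ne_eq, hne r hr, not_false_eq_true, Function.update_of_ne,
        Function.update_self] at h
      exact absurd ⟨r, hr, hr0, h⟩ hnew
    · intro h
      simp only [ne_eq, hne r' hr', not_false_eq_true, Function.update_of_ne,
        Function.update_self] at h
      exact absurd ⟨r', hr', hr0', h.symm⟩ hnew
    · exact fun _ => rfl

theorem represented_push_self {A : ℕ → Finset ℕ} {l : ℕ → ℕ} {t : ℕ} (ht : t ≠ 0) (B : Finset ℕ)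
    (f : ℕ) :
    S.Represented (Function.update A t (insert f B)) (Function.update l t f) (t + 1) B f :=
  ⟨t, by omega, ht, by simp⟩

/-! ### The number of sets found -/

variable (S) in
open scoped Classical in
/-- The cell, of width `1` and height `17 / 10`, of the item `e` in the window left of the
abscissa `X`. -/
noncomputable def cell (X : ℝ) (e : ℕ) : Bool × Bool :=
  (decide (S.x e ≤ X - 1), decide (S.y e ≤ S.y₀ + 7 / 10))

/-- The line at `y₀ + 7 / 10` halves the range [y₀ - 1, y₀ + 12/5] of relevant heights, and 1² +
(17/10)² = 3.89 ≤ 4. -/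
theorem conflict_of_cell_eq {X : ℝ} {e f : ℕ} (he : S.Relevant e) (hf : S.Relevant f)
    (hxe : X - 2 ≤ S.x e) (hxe' : S.x e ≤ X) (hxf : X - 2 ≤ S.x f) (hxf' : S.x f ≤ X)
    (hc : e / S.m = f / S.m) (h : S.cell X e = S.cell X f) : S.Conflict e f := by
  refine ⟨hc, ?_⟩
  simp only [cell, Prod.mk.injEq, decide_eq_decide] at h
  obtain ⟨h1, h2⟩ := h
  have hx : |S.x e - S.x f| ≤ 1 := by
    rw [abs_le]
    by_cases h : S.x e ≤ X - 1
    · have := h1.1 h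
      constructor <;> linarith
    · have := mt h1.2 h
      constructor <;> linarith
  have hy : |S.y e - S.y f| ≤ 17 / 10 := by
    rw [abs_le]
    obtain ⟨a, b⟩ := he
    obtain ⟨c, d⟩ := hf
    by_cases h : S.y e ≤ S.y₀ + 7 / 10
    · have := h2.1 h
      constructor <;> linarith
    · have := mt h2.2 h
      constructor <;> linarith
  have hx' := abs_mul_abs_self (S.x e - S.x f)
  have hy' := abs_mul_abs_self (S.y e - S.y f)
  nlinarith [abs_nonneg (S.x e - S.x f), abs_nonneg (S.y e - S.y f)]

open scoped Classical in
/-- The set of items that has at most one item of each colour in each cell, given by a table. -/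
noncomputable def ofTable (S : StripTask) (g : Fin S.K × Bool × Bool → Option (Fin S.m)) :
    Finset ℕ :=
  (Finset.range (S.m * S.K)).filter fun e =>
    ∃ (c : Fin S.K) (b : Bool × Bool) (d : Fin S.m), g (c, b) = some d ∧ e / S.m = c ∧ e % S.m = d

/-- By `conflict_of_cell_eq` a colour and a cell determine at most one item of the window, so a
table of chosen disks loses nothing. -/
theorem exists_table {A : Finset ℕ} (hA : S.Independent A) {l : ℕ} (hl : ∀ e ∈ A, S.x e ≤ S.x l) :
    ∃ g, S.ofTable g = S.window A l := by
  classical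
  let R : Fin S.K × Bool × Bool → Fin S.m → Prop := fun c d =>
    ∃ e ∈ S.window A l, e / S.m = c.1 ∧ e % S.m = d ∧ S.cell (S.x l) e = c.2
  refine ⟨fun c => if h : ∃ d, R c d then some h.choose else none, ?_⟩
  ext e
  simp only [ofTable, Finset.mem_filter, Finset.mem_range]
  constructor
  · rintro ⟨-, c, b, d, hg, hec, hed⟩
    split_ifs at hg with h
    have hd : h.choose = d := by simpa using hg
    obtain ⟨e', he', h1, h2, -⟩ := h.choose_spec
    rw [hd] at h2
    have : e = e' := by
      rw [← Nat.div_add_mod e S.m, ← Nat.div_add_mod e' S.m, hec, hed, h1, h2]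
    rwa [this]
  · intro he
    have heA := (mem_window.1 he).1
    have hlt := hA.lt e heA
    have hm : 0 < S.m := Nat.pos_of_ne_zero (by rintro h; simp [h] at hlt)
    have hR : ∃ d, R (⟨e / S.m, Nat.div_lt_of_lt_mul hlt⟩, S.cell (S.x l) e) d :=
      ⟨⟨e % S.m, Nat.mod_lt _ hm⟩, e, he, rfl, rfl, rfl⟩
    refine ⟨hlt, ⟨e / S.m, Nat.div_lt_of_lt_mul hlt⟩, S.cell (S.x l) e,
      ⟨e % S.m, Nat.mod_lt _ hm⟩, ?_, rfl, rfl⟩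
    rw [dif_pos hR, Option.some_inj]
    obtain ⟨e', he', h1, h2, h3⟩ := hR.choose_spec
    have heq : e' = e := by
      by_contra hne
      have he'A := (mem_window.1 he').1
      exact hA.not_conflict e' he'A e heA hne (conflict_of_cell_eq (hA.relevant _ he'A)
        (hA.relevant _ heA) (mem_window.1 he').2 (hl _ he'A) (mem_window.1 he).2 (hl _ heA) h1 h3)
    apply Fin.ext
    rw [← h2, heq]

/-- Windows of the sets found are distinct, and tables with `4 * K` entries and `m + 1` values
describe them all. The extra 1 is the initial empty set, which has no last item. -/
theorem Found.card_le {A : ℕ → Finset ℕ} {l : ℕ → ℕ} {t : ℕ} (H : S.Found A l t) :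
    t ≤ 1 + (S.m + 1) ^ (4 * S.K) := by
  classical
  have hT : ∀ q ∈ Finset.Ico 1 t, S.window (A q) (l q) ∈ Finset.univ.image (S.ofTable) := by
    intro q hq
    obtain ⟨h1, h2⟩ := Finset.mem_Ico.1 hq
    obtain ⟨g, hg⟩ := exists_table (H.independent q h2) (H.le_last q h2 (by omega))
    exact Finset.mem_image.2 ⟨g, Finset.mem_univ _, hg⟩
  have hcard := Finset.card_le_card_of_injOn (fun q => S.window (A q) (l q)) hT (by
    intro q hq r hr h
    have hq' := Finset.mem_Ico.1 hq
    have hr' := Finset.mem_Ico.1 hr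
    exact H.window_inj q hq'.2 r hr'.2 (by omega) (by omega) h)
  have himg := (Finset.card_image_le (s := Finset.univ) (f := S.ofTable))
  have hfun : Fintype.card (Fin S.K × Bool × Bool → Option (Fin S.m)) = (S.m + 1) ^ (4 * S.K) := by
    simp [Fintype.card_pi, mul_comm]
  rw [Finset.card_univ, hfun] at himg
  rw [Nat.card_Ico] at hcard
  omega

end StripTask

open RealRAM

/-! ### Names of arrays and variables -/

local notation "vM" => (2 : ℕ)
local notation "vK" => (3 : ℕ)
local notation "vE" => (4 : ℕ)
local notation "vP" => (5 : ℕ)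
local notation "vF" => (6 : ℕ)
local notation "vHead" => (7 : ℕ)
local notation "vTail" => (8 : ℕ)
-- The sets and flags found by the search are stored in consecutive blocks of lengths `m * K` and
-- `n`. As natural numbers cannot be multiplied, the offsets of the head block and of the tail block
-- are kept in variables and advanced by addition.
local notation "vHeadM" => (9 : ℕ)
local notation "vHeadN" => (10 : ℕ)
local notation "vTailM" => (11 : ℕ)
local notation "vTailN" => (12 : ℕ)
local notation "vOk" => (13 : ℕ)
local notation "vKey" => (14 : ℕ)
local notation "vSol" => (15 : ℕ)
local notation "vStamp" => (16 : ℕ)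
local notation "vFound" => (17 : ℕ)
local notation "vOff" => (18 : ℕ)
local notation "vC" => (19 : ℕ)
local notation "vPow" => (20 : ℕ)
local notation "aDisk" => (21 : ℕ)
local notation "aCol" => (22 : ℕ)
local notation "aPow" => (23 : ℕ)
local notation "aSet" => (24 : ℕ)
local notation "aFlag" => (25 : ℕ)
local notation "aVis" => (26 : ℕ)
local notation "aDone" => (27 : ℕ)

attribute [local simp] Program.run IntExp.eval RealExp.eval Store.setInt_int_self
  Store.setInt_int_of_ne Store.setInt_real Store.setReal_int Store.setReal_real_self
  Store.setReal_real_of_ne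

namespace StripTask

/-- The memory holds the data of the task. -/
structure HeldBy (S : StripTask) (s : Store) : Prop where
  n : s.int 0 0 = S.n
  M : s.int vM 0 = S.m * S.K
  disk : ∀ e < S.m * S.K, s.int aDisk e = e % S.m
  col : ∀ e < S.m * S.K, s.int aCol e = e / S.m
  pow : ∀ e < S.m * S.K, s.int aPow e = 2 ^ e
  px : s.real 0 = S.px
  py : s.real 1 = S.py
  dx : s.real 2 = S.dx
  dy : s.real 3 = S.dy
  y₀ : s.real 4 0 = S.y₀

/-- The program does not assign to the arrays that hold the data of a task. -/
def keepsTask (p : Program) : Bool :=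
  !(p.writesInt 0 || p.writesInt vM || p.writesInt aDisk || p.writesInt aCol || p.writesInt aPow
    || p.writesReal 0 || p.writesReal 1 || p.writesReal 2 || p.writesReal 3 || p.writesReal 4)

theorem HeldBy.of_sameOff {S : StripTask} {p : Program} {s s' : Store} (h : S.HeldBy s)
    (hs : SameOff p s s') (hp : keepsTask p = true) : S.HeldBy s' := by
  simp only [keepsTask, Bool.not_eq_true', Bool.or_eq_false_iff] at hp
  obtain ⟨⟨⟨⟨⟨⟨⟨⟨⟨h0, h1⟩, h2⟩, h3⟩, h4⟩, h5⟩, h6⟩, h7⟩, h8⟩, h9⟩ := hp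
  obtain ⟨g0, g1, g2, g3, g4, g5, g6, g7, g8, g9⟩ := h
  constructor <;> simpa [hs.int _ h0, hs.int _ h1, hs.int _ h2, hs.int _ h3, hs.int _ h4,
    hs.real _ h5, hs.real _ h6, hs.real _ h7, hs.real _ h8, hs.real _ h9]

theorem HeldBy.setInt {S : StripTask} {s : Store} (h : S.HeldBy s) {a : ℕ} (i v : ℕ)
    (ha : a ≠ 0 ∧ a ≠ vM ∧ a ≠ aDisk ∧ a ≠ aCol ∧ a ≠ aPow) : S.HeldBy (s.setInt a i v) := by
  obtain ⟨h0, h1, h2, h3, h4⟩ := ha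
  obtain ⟨g0, g1, g2, g3, g4, g5, g6, g7, g8, g9⟩ := h
  constructor <;> simpa [h0.symm, h1.symm, h2.symm, h3.symm, h4.symm]

end StripTask

namespace CoverProgram

/-! ### One extension step -/

abbrev sq (e : RealExp) : RealExp := .mul e e

/-- The coordinates of the disk of the item held by the variable `v`. -/
abbrev itemX (v : ℕ) : RealExp := .get 2 (.get aDisk (.var v))

abbrev itemY (v : ℕ) : RealExp := .get 3 (.get aDisk (.var v))

abbrev pointX : RealExp := .get 0 (.var vP)

abbrev pointY : RealExp := .get 1 (.var vP)

abbrev positive (e : IntExp) : Test := .intLe (.const 1) e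

theorem holds_positive (e : IntExp) (s : Store) : (positive e).Holds s ↔ 0 < e.eval s := Iff.rfl

attribute [local simp] holds_positive

/-- The item `vE` is not to the right of the item `vF` and not in conflict with it. -/
def precedesTest : Test :=
  .and (.realLe (itemX vE) (itemX vF)) (.not (.and (.and
      (.intLe (.get aCol (.var vE)) (.get aCol (.var vF)))
      (.intLe (.get aCol (.var vF)) (.get aCol (.var vE))))
    (.realLe (.add (sq (.sub (itemX vE) (itemX vF))) (sq (.sub (itemY vE) (itemY vF))))
      (.const 4))))

theorem holds_precedesTest {S : StripTask} {s : Store} (hS : S.HeldBy s)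
    (he : s.int vE 0 < S.m * S.K) (hf : s.int vF 0 < S.m * S.K) :
    precedesTest.Holds s ↔ S.x (s.int vE 0) ≤ S.x (s.int vF 0) ∧
      ¬ S.Conflict (s.int vE 0) (s.int vF 0) := by
  simp [precedesTest, Test.Holds, StripTask.Conflict, StripTask.x, StripTask.y, hS.disk _ he,
    hS.disk _ hf, hS.col _ he, hS.col _ hf, hS.dx, hS.dy, le_antisymm_iff]

/-- The item `vE` is in the window of the item `vF`. -/
def windowTest : Test := .realLe (.sub (itemX vF) (.const 2)) (itemX vE)

theorem holds_windowTest {S : StripTask} {s : Store} (hS : S.HeldBy s)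
    (he : s.int vE 0 < S.m * S.K) (hf : s.int vF 0 < S.m * S.K) :
    windowTest.Holds s ↔ S.x (s.int vF 0) - 2 ≤ S.x (s.int vE 0) := by
  simp [windowTest, Test.Holds, StripTask.x, hS.disk _ he, hS.disk _ hf, hS.dx]

/-- The disk of the item `vF` contains the point `vP`. -/
def coversTest : Test :=
  .realLe (.add (sq (.sub pointX (itemX vF))) (sq (.sub pointY (itemY vF)))) (.const 1)

theorem holds_coversTest {S : StripTask} {s : Store} (hS : S.HeldBy s)
    (hf : s.int vF 0 < S.m * S.K) :
    coversTest.Holds s ↔ S.Covers (s.int vF 0) (s.int vP 0) := by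
  simp [coversTest, Test.Holds, StripTask.Covers, StripTask.x, StripTask.y, hS.disk _ hf, hS.dx,
    hS.dy, hS.px, hS.py]

/-- The point `vP` may still be covered by items to the right of the item `vF`. -/
def laterTest : Test := .realLe (.sub (itemX vF) (.const 1)) pointX

theorem holds_laterTest {S : StripTask} {s : Store} (hS : S.HeldBy s)
    (hf : s.int vF 0 < S.m * S.K) :
    laterTest.Holds s ↔ S.x (s.int vF 0) - 1 ≤ S.px (s.int vP 0) := by
  simp [laterTest, Test.Holds, StripTask.x, hS.disk _ hf, hS.dx, hS.px]

/-- The disk of the item `vF` is close enough to the strip. -/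
def relevantTest : Test :=
  .and (.realLe (.sub (.get 4 (.const 0)) (.const 1)) (itemY vF))
    (.realLe (itemY vF) (.add (.get 4 (.const 0)) (.const (12 / 5))))

theorem holds_relevantTest {S : StripTask} {s : Store} (hS : S.HeldBy s)
    (hf : s.int vF 0 < S.m * S.K) :
    relevantTest.Holds s ↔ S.Relevant (s.int vF 0) := by
  simp [relevantTest, Test.Holds, StripTask.Relevant, StripTask.y, hS.disk _ hf, hS.dy, hS.y₀]

abbrev copyItemsBody : Program :=
  .seq (.setInt aSet (.add (.var vTailM) (.var vE)) (.get aSet (.add (.var vHeadM) (.var vE))))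
    (.ifElse (positive (.get aSet (.add (.var vHeadM) (.var vE))))
      (.seq
        (.ifElse precedesTest .skip (.setVar vOk (.const 0)))
        (.ifElse windowTest
          (.setVar vKey (.add (.var vKey) (.get aPow (.var vE)))) .skip))
      .skip)

/-- Copies the set at the head to the tail and checks whether the item `vF` may be added. -/
def copyItems : Program := .forLoop vE (.var vM) copyItemsBody

/-- The tail block is scratch space, filled before it is known whether the extension is allowed and
overwritten by the next attempt after a rejection. Hence only the cells below `t` are claimed to
survive; `hle` places the block being read among them. -/
theorem copyItems_runs {S : StripTask} {s : Store} (hS : S.HeldBy s) {f h t : ℕ}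
    (hf : s.int vF 0 = f) (hfM : f < S.m * S.K) (hh : s.int vHeadM 0 = h)
    (ht : s.int vTailM 0 = t) (hle : h + S.m * S.K ≤ t) {A : Finset ℕ}
    (hA : ∀ e < S.m * S.K, 0 < s.int aSet (h + e) ↔ e ∈ A) (hAM : ∀ e ∈ A, e < S.m * S.K) :
    Runs copyItems s (200 * (S.m * S.K + 1)) fun s' =>
      (∀ e < S.m * S.K, 0 < s'.int aSet (t + e) ↔ e ∈ A) ∧
      (∀ i < t, s'.int aSet i = s.int aSet i) ∧
      (0 < s'.int vOk 0 ↔ 0 < s.int vOk 0 ∧ ∀ e ∈ A, S.x e ≤ S.x f ∧ ¬ S.Conflict e f) ∧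
      s'.int vKey 0 = s.int vKey 0 + ∑ e ∈ S.window A f, 2 ^ e := by
  classical
  refine (Runs.forLoop (S.m * S.K) 150 (fun j s' =>
      (∀ e < j, 0 < s'.int aSet (t + e) ↔ e ∈ A) ∧
      (∀ i < t, s'.int aSet i = s.int aSet i) ∧
      (0 < s'.int vOk 0 ↔
        0 < s.int vOk 0 ∧ ∀ e ∈ A, e < j → S.x e ≤ S.x f ∧ ¬ S.Conflict e f) ∧
      s'.int vKey 0 = s.int vKey 0 + ∑ e ∈ (S.window A f).filter (· < j), 2 ^ e)
      ?_ rfl ?_ ?_).mono ?_ ?_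
  · intro s' hs'
    exact (hS.of_sameOff hs' rfl).M
  · simp
  · rintro j s' hj hs' hv ⟨h1, h2, h3, h4⟩
    have hS' := hS.of_sameOff hs' rfl
    have hf' : s'.int vF 0 = f := by rw [hs'.int vF rfl, hf]
    have hh' : s'.int vHeadM 0 = h := by rw [hs'.int vHeadM rfl, hh]
    have ht' : s'.int vTailM 0 = t := by rw [hs'.int vTailM rfl, ht]
    have hup (v : ℕ) : Function.update (s'.int aSet) (t + j) v (h + j) = s'.int aSet (h + j) :=
      Function.update_of_ne (by omega) _ _
    have hhj : s'.int aSet (h + j) = s.int aSet (h + j) := h2 _ (by omega)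
    have hnew : ∀ e ≤ j, 0 < Function.update (s'.int aSet) (t + j) (s'.int aSet (h + j)) (t + e)
        ↔ e ∈ A := by
      intro e he
      rcases he.lt_or_eq with he | rfl
      · rw [Function.update_of_ne (by omega), h1 e he]
      · rw [Function.update_self, hhj, hA e hj]
    have hold : ∀ i < t, Function.update (s'.int aSet) (t + j) (s'.int aSet (h + j)) i
        = s.int aSet i := by
      intro i hi
      rw [Function.update_of_ne (by omega), h2 i hi]
    have hall : (∀ e ∈ A, e < j + 1 → S.x e ≤ S.x f ∧ ¬ S.Conflict e f) ↔
        (∀ e ∈ A, e < j → S.x e ≤ S.x f ∧ ¬ S.Conflict e f) ∧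
        (j ∈ A → S.x j ≤ S.x f ∧ ¬ S.Conflict j f) := by
      simp only [Nat.lt_succ_iff_lt_or_eq, or_imp, forall_and]
      aesop
    have hsum : ∑ e ∈ (S.window A f).filter (· < j + 1), 2 ^ e =
        ∑ e ∈ (S.window A f).filter (· < j), 2 ^ e + if j ∈ S.window A f then 2 ^ j else 0 := by
      split_ifs with hjw
      · rw [show (S.window A f).filter (· < j + 1) = insert j ((S.window A f).filter (· < j)) by
          ext e; simp only [Finset.mem_filter, Finset.mem_insert]; grind]
        rw [Finset.sum_insert (by simp), add_comm]
      · congr 1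
        ext e
        simp only [Finset.mem_filter]
        grind
    refine Runs.run_of rfl (by decide) ?_
    have hpos := hA j hj
    rw [hall, hsum]
    rw [← hhj] at hpos
    have hpre := @holds_precedesTest S
    have hwin := @holds_windowTest S
    have hS₁ (i v : ℕ) : S.HeldBy (s'.setInt aSet i v) := hS'.setInt _ _ (by simp)
    have hS₂ (i v : ℕ) : S.HeldBy ((s'.setInt aSet i v).setInt vOk 0 0) :=
      (hS₁ i v).setInt _ _ (by simp)
    by_cases hjA : j ∈ A
    · by_cases h5 : S.x j ≤ S.x f ∧ ¬ S.Conflict j f <;>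
      by_cases h6 : S.x f - 2 ≤ S.x j <;>
      simp [hv, hf', hh', ht', hup, hpos, hpre, hwin, hS₁, hS₂, hS'.pow, hj, hfM, hjA,
        h5, h6, StripTask.mem_window, h3, h4, add_assoc] <;>
      exact ⟨hnew, hold⟩
    · simp [hv, hh', ht', hup, hpos, hjA, StripTask.mem_window, h3, h4]
      exact ⟨hnew, hold⟩
  · simp only [IntExp.cost]
    omega
  · rintro s' - ⟨h1, h2, h3, h4⟩
    refine ⟨h1, h2, ?_, ?_⟩
    · rw [h3]
      refine and_congr_right fun _ => ⟨fun h e he => h e he (hAM e he), fun h e he _ => h e he⟩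
    · rw [h4, Finset.filter_true_of_mem fun e he => hAM e (StripTask.mem_window.1 he).1]

end CoverProgram

/-! ### Invariant of the queue of sets. -/

namespace StripTask

/-- The first `t` sets of the second search are those of the first one. -/
def Prolongs (A : ℕ → Finset ℕ) (l : ℕ → ℕ) (t : ℕ) (A' : ℕ → Finset ℕ) (l' : ℕ → ℕ) (t' : ℕ) :
    Prop :=
  t ≤ t' ∧ ∀ q < t, A' q = A q ∧ l' q = l q

theorem Prolongs.refl (A : ℕ → Finset ℕ) (l : ℕ → ℕ) (t : ℕ) : Prolongs A l t A l t :=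
  ⟨le_rfl, fun _ _ => ⟨rfl, rfl⟩⟩

theorem Prolongs.trans {A A' A'' : ℕ → Finset ℕ} {l l' l'' : ℕ → ℕ} {t t' t'' : ℕ}
    (h : Prolongs A l t A' l' t') (h' : Prolongs A' l' t' A'' l'' t'') :
    Prolongs A l t A'' l'' t'' :=
  ⟨h.1.trans h'.1, fun q hq => ⟨((h'.2 q (hq.trans_le h.1)).1).trans (h.2 q hq).1,
    ((h'.2 q (hq.trans_le h.1)).2).trans (h.2 q hq).2⟩⟩

theorem Represented.mono {S : StripTask} {A A' : ℕ → Finset ℕ} {l l' : ℕ → ℕ} {t t' : ℕ}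
    {B : Finset ℕ} {f : ℕ} (h : S.Represented A l t B f) (hA : Prolongs A l t A' l' t') :
    S.Represented A' l' t' B f := by
  obtain ⟨q, hq, hq0, hw⟩ := h
  exact ⟨q, hq.trans_le hA.1, hq0, by rw [(hA.2 q hq).1, (hA.2 q hq).2, hw]⟩

/-- The memory holds the sets found by the search and the table of their windows. -/
structure SearchState (S : StripTask) (c : ℕ) (A : ℕ → Finset ℕ) (l : ℕ → ℕ) (t : ℕ) (s : Store) :
    Prop where
  found : S.Found A l t
  tail : s.int vTail 0 = t
  tailM : s.int vTailM 0 = t * (S.m * S.K)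
  tailN : s.int vTailN 0 = t * S.n
  set : ∀ q < t, ∀ e < S.m * S.K, 0 < s.int aSet (q * (S.m * S.K) + e) ↔ e ∈ A q
  flag : ∀ q < t, ∀ p < S.n, 0 < s.int aFlag (q * S.n + p) ↔ S.CoveredBy (A q) p
  stamp : s.int vStamp 0 = c
  vis_le : ∀ κ, s.int aVis κ ≤ c
  vis : ∀ κ, s.int aVis κ = c ↔ ∃ q < t, q ≠ 0 ∧ ∑ e ∈ S.window (A q) (l q), 2 ^ e = κ

end StripTask

namespace CoverProgram

open StripTask

attribute [local simp] holds_positive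

abbrev copyFlagsBody : Program :=
  .ifElse (positive (.get aFlag (.add (.var vHeadN) (.var vP))))
    (.setInt aFlag (.add (.var vTailN) (.var vP)) (.const 1))
    (.seq (.ifElse laterTest .skip (.setVar vOk (.const 0)))
      (.ifElse coversTest (.setInt aFlag (.add (.var vTailN) (.var vP)) (.const 1))
        (.setInt aFlag (.add (.var vTailN) (.var vP)) (.const 0))))

/-- Computes the flags of the set at the tail and checks whether a point was left uncovered. -/
def copyFlags : Program := .forLoop vP (.var 0) copyFlagsBody

/-- A flag of the extended set is the old flag or the test for the single new disk, so a point takes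
constant time however large the set is. In the search a flag means `CoveredBy`, hence points that
need no covering are flagged from the start. -/
theorem copyFlags_runs {S : StripTask} {s : Store} (hS : S.HeldBy s) {f h t : ℕ}
    (hf : s.int vF 0 = f) (hfM : f < S.m * S.K) (hh : s.int vHeadN 0 = h)
    (ht : s.int vTailN 0 = t) (hle : h + S.n ≤ t) :
    Runs copyFlags s (200 * (S.n + 1)) fun s' =>
      (∀ p < S.n, 0 < s'.int aFlag (t + p) ↔ 0 < s.int aFlag (h + p) ∨ S.Covers f p) ∧
      (∀ i < t, s'.int aFlag i = s.int aFlag i) ∧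
      (0 < s'.int vOk 0 ↔ 0 < s.int vOk 0 ∧
        ∀ p < S.n, 0 < s.int aFlag (h + p) ∨ S.x f - 1 ≤ S.px p) := by
  refine (Runs.forLoop S.n 150 (fun j s' =>
      (∀ p < j, 0 < s'.int aFlag (t + p) ↔ 0 < s.int aFlag (h + p) ∨ S.Covers f p) ∧
      (∀ i < t, s'.int aFlag i = s.int aFlag i) ∧
      (0 < s'.int vOk 0 ↔ 0 < s.int vOk 0 ∧
        ∀ p < j, 0 < s.int aFlag (h + p) ∨ S.x f - 1 ≤ S.px p))
      ?_ rfl ?_ ?_).mono ?_ ?_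
  · intro s' hs'
    exact (hS.of_sameOff hs' rfl).n
  · simp
  · rintro j s' hj hs' hv ⟨h1, h2, h3⟩
    have hS' := hS.of_sameOff hs' rfl
    have hf' : s'.int vF 0 = f := by rw [hs'.int vF rfl, hf]
    have hh' : s'.int vHeadN 0 = h := by rw [hs'.int vHeadN rfl, hh]
    have ht' : s'.int vTailN 0 = t := by rw [hs'.int vTailN rfl, ht]
    have hhj : s'.int aFlag (h + j) = s.int aFlag (h + j) := h2 _ (by omega)
    have hnew (v : ℕ) (hv : 0 < v ↔ 0 < s.int aFlag (h + j) ∨ S.Covers f j) :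
        ∀ p ≤ j, 0 < Function.update (s'.int aFlag) (t + j) v (t + p) ↔
          0 < s.int aFlag (h + p) ∨ S.Covers f p := by
      intro p hp
      rcases hp.lt_or_eq with hp | rfl
      · rw [Function.update_of_ne (by omega), h1 p hp]
      · rw [Function.update_self, hv]
    have hold (v : ℕ) : ∀ i < t, Function.update (s'.int aFlag) (t + j) v i = s.int aFlag i := by
      intro i hi
      rw [Function.update_of_ne (by omega), h2 i hi]
    have hall : (∀ p < j + 1, 0 < s.int aFlag (h + p) ∨ S.x f - 1 ≤ S.px p) ↔
        (∀ p < j, 0 < s.int aFlag (h + p) ∨ S.x f - 1 ≤ S.px p) ∧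
        (0 < s.int aFlag (h + j) ∨ S.x f - 1 ≤ S.px j) := Nat.forall_lt_succ_right
    refine Runs.run_of rfl (by decide) ?_
    rw [hall]
    have hlat := @holds_laterTest S
    have hcov := @holds_coversTest S
    have hS₂ : S.HeldBy (s'.setInt vOk 0 0) := hS'.setInt _ _ (by simp)
    by_cases h4 : 0 < s.int aFlag (h + j)
    · simp [hv, hh', ht', hhj, h3, h4]
      exact ⟨hnew 1 (by simp [h4]), hold 1⟩
    · by_cases h5 : S.x f - 1 ≤ S.px j <;>
      by_cases h6 : S.Covers f j <;>
      simp [hlat, hcov, hS', hS₂, hfM, hv, hh', hf', hhj, ht', h3, h4, h5, h6] <;>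
      first
        | exact ⟨hnew 1 (by simp [h6]), hold 1⟩
        | exact ⟨hnew 0 (by simp [h4, h6]), hold 0⟩
  · simp only [IntExp.cost]
    omega
  · rintro s' - h
    exact h

/-- Puts the set at the tail into the queue if it may be used and its window is new. -/
def enqueue : Program :=
  .ifElse (.and (positive (.var vOk)) (.not (.intLe (.var vStamp) (.get aVis (.var vKey)))))
    (.seq (.setInt aVis (.var vKey) (.var vStamp))
      (.seq (.setVar vTail (.add (.var vTail) (.const 1)))
        (.seq (.setVar vTailM (.add (.var vTailM) (.var vM)))
          (.setVar vTailN (.add (.var vTailN) (.var 0))))))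
    .skip

/-- Tries to add the item `vF` to the set at the head. -/
def tryItem : Program :=
  .seq (.seq (.ifElse relevantTest (.setVar vOk (.const 1)) (.setVar vOk (.const 0)))
      (.setVar vKey (.get aPow (.var vF))))
    (.seq copyItems
      (.seq (.setInt aSet (.add (.var vTailM) (.var vF)) (.const 1)) (.seq copyFlags enqueue)))

-- The test for a new window is one memory access: the key is the bit mask of the window of the
-- extended set, and `aVis` holds the current stamp exactly at the keys already seen. Either the
-- attempt leaves the queue as it was, or `Found.push` applies.
set_option maxHeartbeats 400000 in
theorem tryItem_runs {S : StripTask} {s : Store} (hS : S.HeldBy s) {c f h t : ℕ}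
    {A : ℕ → Finset ℕ} {l : ℕ → ℕ} (hs : S.SearchState c A l t s)
    (hf : s.int vF 0 = f) (hfM : f < S.m * S.K) (hh : h < t)
    (hM : s.int vHeadM 0 = h * (S.m * S.K)) (hN : s.int vHeadN 0 = h * S.n) :
    Runs tryItem s (500 * (S.m * S.K + S.n + 1)) fun s' => ∃ A' l' t', S.SearchState c A' l' t' s' ∧
      Prolongs A l t A' l' t' ∧ (S.Extends (A h) f → S.Represented A' l' t' (A h) f) := by
  have hFound := hs.found
  have hAM : ∀ e ∈ A h, e < S.m * S.K := (hFound.independent h hh).lt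
  have hleM : h * (S.m * S.K) + S.m * S.K ≤ t * (S.m * S.K) := by
    rw [← Nat.succ_mul]
    exact Nat.mul_le_mul_right _ hh
  have hleN : h * S.n + S.n ≤ t * S.n := by
    rw [← Nat.succ_mul]
    exact Nat.mul_le_mul_right _ hh
  have hstart : Runs (.seq (.ifElse relevantTest (.setVar vOk (.const 1)) (.setVar vOk (.const 0)))
      (.setVar vKey (.get aPow (.var vF)))) s 50
      fun s' => (0 < s'.int vOk 0 ↔ S.Relevant f) ∧ s'.int vKey 0 = 2 ^ f := by
    refine Runs.run_of rfl (by decide) ?_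
    have hrel := holds_relevantTest hS (by rwa [hf])
    rw [hf] at hrel
    by_cases h1 : S.Relevant f <;> simp [hrel, h1, hf, hS.pow f hfM]
  refine (Runs.seq_of hstart fun s₁ hs₁ ⟨hok₁, hkey₁⟩ => Runs.seq_of
    (copyItems_runs (hS.of_sameOff hs₁ rfl) (f := f) (h := h * (S.m * S.K)) (t := t * (S.m * S.K))
      (A := A h) (by rw [hs₁.int _ rfl, hf]) hfM (by rw [hs₁.int _ rfl, hM])
      (by rw [hs₁.int _ rfl, hs.tailM]) hleM (by rw [hs₁.int _ rfl]; exact hs.set h hh) hAM)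
    fun s₂ hs₂ ⟨hnew₂, hold₂, hok₂, hkey₂⟩ => Runs.seq_of (Runs.of_loopFree rfl s₂)
    fun s₃ hs₃ hrun₃ => Runs.seq_of (T' := 50)
    (copyFlags_runs (((hS.of_sameOff hs₁ rfl).of_sameOff hs₂ rfl).of_sameOff hs₃ rfl)
      (f := f) (h := h * S.n) (t := t * S.n)
      (by rw [hs₃.int _ rfl, hs₂.int _ rfl, hs₁.int _ rfl, hf]) hfM
      (by rw [hs₃.int _ rfl, hs₂.int _ rfl, hs₁.int _ rfl, hN])
      (by rw [hs₃.int _ rfl, hs₂.int _ rfl, hs₁.int _ rfl, hs.tailN]) hleN)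
    fun s₄ hs₄ ⟨hnew₄, hold₄, hok₄⟩ => Runs.run_of rfl (by decide)
      (Q := fun s' => ∃ A' l' t', S.SearchState c A' l' t' s' ∧
      Prolongs A l t A' l' t' ∧ (S.Extends (A h) f → S.Represented A' l' t' (A h) f)) ?_).mono
      ?_ fun _ _ h => h
  swap
  · simp only [Program.maxCost, IntExp.cost]
    omega
  have hvF : s₂.int vF 0 = f := by rw [hs₂.int _ rfl, hs₁.int _ rfl, hf]
  have htM : s₂.int vTailM 0 = t * (S.m * S.K) := by
    rw [hs₂.int _ rfl, hs₁.int _ rfl, hs.tailM]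
  have hflag : s₃.int aFlag = s.int aFlag := by
    rw [hs₃.int _ rfl, hs₂.int _ rfl, hs₁.int _ rfl]
  have hset : s₄.int aSet = Function.update (s₂.int aSet) (t * (S.m * S.K) + f) 1 := by
    rw [hs₄.int _ rfl, hrun₃]
    simp [hvF, htM]
  have hkey : s₄.int vKey 0 = 2 ^ f + ∑ e ∈ S.window (A h) f, 2 ^ e := by
    rw [hs₄.int _ rfl, hs₃.int _ rfl, hkey₂, hkey₁]
  have hok : 0 < s₄.int vOk 0 ↔ S.Extends (A h) f := by
    rw [hok₄, hs₃.int vOk rfl, hok₂, hok₁, hflag]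
    constructor
    · rintro ⟨⟨h1, h2⟩, h3⟩
      refine ⟨h1, fun e he => (h2 e he).1, fun e he => (h2 e he).2, fun p hp hlt => ?_⟩
      rcases h3 p hp with h4 | h4
      · exact (hs.flag h hh p hp).1 h4
      · linarith
    · rintro ⟨h1, h2, h3, h4⟩
      refine ⟨⟨h1, fun e he => ⟨h2 e he, h3 e he⟩⟩, fun p hp => ?_⟩
      rw [or_iff_not_imp_right, not_le, hs.flag h hh p hp]
      exact h4 p hp
  have hsetold : ∀ q < t, ∀ e < S.m * S.K,
      s₄.int aSet (q * (S.m * S.K) + e) = s.int aSet (q * (S.m * S.K) + e) := by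
    intro q hq e he
    have : q * (S.m * S.K) + S.m * S.K ≤ t * (S.m * S.K) := by
      rw [← Nat.succ_mul]
      exact Nat.mul_le_mul_right _ hq
    rw [hset, Function.update_of_ne (by omega), hold₂ _ (by omega), hs₁.int _ rfl]
  have hflagold : ∀ q < t, ∀ p < S.n, s₄.int aFlag (q * S.n + p) = s.int aFlag (q * S.n + p) := by
    intro q hq p hp
    have : q * S.n + S.n ≤ t * S.n := by
      rw [← Nat.succ_mul]
      exact Nat.mul_le_mul_right _ hq
    rw [hold₄ _ (by omega), hflag]
  have hTail : s₄.int vTail 0 = t := by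
    rw [hs₄.int _ rfl, hs₃.int _ rfl, hs₂.int _ rfl, hs₁.int _ rfl, hs.tail]
  have hTailM : s₄.int vTailM 0 = t * (S.m * S.K) := by
    rw [hs₄.int _ rfl, hs₃.int _ rfl, htM]
  have hTailN : s₄.int vTailN 0 = t * S.n := by
    rw [hs₄.int _ rfl, hs₃.int _ rfl, hs₂.int _ rfl, hs₁.int _ rfl, hs.tailN]
  have hStamp : s₄.int vStamp 0 = c := by
    rw [hs₄.int _ rfl, hs₃.int _ rfl, hs₂.int _ rfl, hs₁.int _ rfl, hs.stamp]
  have hVis : s₄.int aVis = s.int aVis := by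
    rw [hs₄.int _ rfl, hs₃.int _ rfl, hs₂.int _ rfl, hs₁.int _ rfl]
  have hvM : s₄.int vM 0 = S.m * S.K := by
    rw [hs₄.int _ rfl, hs₃.int _ rfl, hs₂.int _ rfl, hs₁.int _ rfl, hS.M]
  have hvN : s₄.int 0 0 = S.n := by
    rw [hs₄.int _ rfl, hs₃.int _ rfl, hs₂.int _ rfl, hs₁.int _ rfl, hS.n]
  -- Everything written so far lies in the tail block or in auxiliary variables, outside the scope
  -- of the invariant.
  have hsame : S.SearchState c A l t s₄ :=
    ⟨hFound, hTail, hTailM, hTailN, fun q hq e he => by rw [hsetold q hq e he, hs.set q hq e he],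
      fun q hq p hp => by rw [hflagold q hq p hp, hs.flag q hq p hp], hStamp,
      by rw [hVis]; exact hs.vis_le, by rw [hVis]; exact hs.vis⟩
  by_cases hext : S.Extends (A h) f
  swap
  · refine ⟨A, l, t, ?_, Prolongs.refl _ _ _, fun h => absurd h hext⟩
    have : s₄.int vOk 0 = 0 := by
      rw [← not_lt.trans Nat.le_zero, hok]
      exact hext
    simpa [enqueue, Test.Holds, this] using hsame
  have hwin : S.window (insert f (A h)) f = insert f (S.window (A h) f) := by
    ext e
    simp only [mem_window, Finset.mem_insert]
    constructor
    · rintro ⟨rfl | h1, h2⟩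
      · exact Or.inl rfl
      · exact Or.inr ⟨h1, h2⟩
    · rintro (rfl | ⟨h1, h2⟩)
      · exact ⟨Or.inl rfl, by linarith⟩
      · exact ⟨Or.inr h1, h2⟩
  have hkey' : s₄.int vKey 0 = ∑ e ∈ S.window (insert f (A h)) f, 2 ^ e := by
    rw [hwin, Finset.sum_insert fun h => hext.notMem (mem_window.1 h).1, hkey]
  -- Finite sets with equal bit masks are equal.
  have hrep : s₄.int aVis (s₄.int vKey 0) = c ↔ S.Represented A l t (A h) f := by
    rw [hsame.vis, hkey']
    exact exists_congr fun q => and_congr_right fun _ => and_congr_right fun _ =>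
      (Finset.geomSum_injective le_rfl).eq_iff
  have hlec := hsame.vis_le (s₄.int vKey 0)
  by_cases hR : S.Represented A l t (A h) f
  · refine ⟨A, l, t, ?_, Prolongs.refl _ _ _, fun _ => hR⟩
    simpa [enqueue, Test.Holds, hrep.2 hR, hStamp] using hsame
  · have hlt : s₄.int aVis (s₄.int vKey 0) < c := lt_of_le_of_ne hlec (mt hrep.1 hR)
    have ht0 : t ≠ 0 := hFound.pos.ne'
    refine ⟨Function.update A t (insert f (A h)), Function.update l t f, t + 1, ?_,
      ⟨by omega, fun q hq => ?_⟩, fun _ => represented_push_self ht0 _ _⟩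
    rotate_left
    · rw [Function.update_of_ne hq.ne, Function.update_of_ne hq.ne]
      exact ⟨rfl, rfl⟩
    have hrun : enqueue.run s₄ = (((s₄.setInt aVis (s₄.int vKey 0) c).setInt vTail 0 (t + 1)).setInt
        vTailM 0 (t * (S.m * S.K) + S.m * S.K)).setInt vTailN 0 (t * S.n + S.n) := by
      simp [enqueue, Test.Holds, hok.2 hext, Nat.succ_le_iff, hStamp, hlt, hTail, hTailM, hTailN,
        hvM, hvN]
    rw [hrun]
    refine ⟨hFound.push hh hfM hext hR, by simp, by simp [Nat.succ_mul], by simp [Nat.succ_mul],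
      ?_, ?_, by simpa using hStamp, ?_, ?_⟩
    · intro q hq e he
      rcases Nat.lt_succ_iff_lt_or_eq.1 hq with hq | rfl
      · simpa [hq.ne] using hsame.set q hq e he
      · simp only [ne_eq, Nat.reduceEqDiff, not_false_eq_true, Store.setInt_int_of_ne,
          Function.update_self, Finset.mem_insert, hset]
        rcases eq_or_ne e f with rfl | hef
        · simp
        · rw [Function.update_of_ne (by omega), hnew₂ e he]
          simp [hef]
    · intro q hq p hp
      rcases Nat.lt_succ_iff_lt_or_eq.1 hq with hq | rfl
      · simpa [hq.ne] using hsame.flag q hq p hp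
      · simp only [ne_eq, Nat.reduceEqDiff, not_false_eq_true, Store.setInt_int_of_ne,
          Function.update_self]
        rw [hnew₄ p hp, hflag, hs.flag h hh p hp]
        simp only [CoveredBy, Finset.mem_insert, exists_eq_or_imp]
        constructor
        · rintro (h1 | h1) hn
          · exact Or.inr (h1 hn)
          · exact Or.inl h1
        · intro h1
          by_cases h2 : S.Covers f p
          · exact Or.inr h2
          · exact Or.inl fun hn => (h1 hn).resolve_left h2
    · intro κ
      simp only [ne_eq, Nat.reduceEqDiff, not_false_eq_true, Store.setInt_int_of_ne,
        Store.setInt_int_self, Function.update_apply]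
      split_ifs
      · exact le_rfl
      · exact hsame.vis_le κ
    · intro κ
      simp only [ne_eq, Nat.reduceEqDiff, not_false_eq_true, Store.setInt_int_of_ne,
        Store.setInt_int_self, Function.update_apply (s₄.int aVis)]
      split_ifs with hκ
      · refine iff_of_true rfl ⟨t, by omega, ht0, ?_⟩
        rw [Function.update_self, Function.update_self, hκ, hkey']
      · rw [hsame.vis κ]
        constructor
        · rintro ⟨q, hq, hq0, hw⟩
          exact ⟨q, by omega, hq0, by simpa [hq.ne] using hw⟩
        · rintro ⟨q, hq, hq0, hw⟩
          rcases Nat.lt_succ_iff_lt_or_eq.1 hq with hq | rfl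
          · exact ⟨q, hq, hq0, by simpa [hq.ne] using hw⟩
          · rw [Function.update_self, Function.update_self, ← hkey'] at hw
            exact absurd hw.symm hκ

end CoverProgram

namespace CoverProgram

open StripTask

attribute [local simp] holds_positive

/-! ### The search -/

def checkFlags : Program :=
  .forLoop vP (.var 0) (.ifElse (positive (.get aFlag (.add (.var vHeadN) (.var vP)))) .skip
    (.setVar vOk (.const 0)))

theorem checkFlags_runs {S : StripTask} {s : Store} (hS : S.HeldBy s) {h : ℕ}
    (hh : s.int vHeadN 0 = h) :
    Runs checkFlags s (50 * (S.n + 1)) fun s' =>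
      (0 < s'.int vOk 0 ↔ 0 < s.int vOk 0 ∧ ∀ p < S.n, 0 < s.int aFlag (h + p)) := by
  refine (Runs.forLoop S.n 30 (fun j s' =>
      (0 < s'.int vOk 0 ↔ 0 < s.int vOk 0 ∧ ∀ p < j, 0 < s.int aFlag (h + p)))
      ?_ rfl ?_ ?_).mono ?_ fun _ _ h => h
  · intro s' hs'
    exact (hS.of_sameOff hs' rfl).n
  · simp
  · rintro j s' hj hs' hv h1
    have hh' : s'.int vHeadN 0 = h := by rw [hs'.int vHeadN rfl, hh]
    have hfl : s'.int aFlag = s.int aFlag := hs'.int _ rfl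
    refine Runs.run_of rfl (by decide) ?_
    rw [Nat.forall_lt_succ_right]
    by_cases h2 : 0 < s.int aFlag (h + j) <;> simp [hv, hh', hfl, h1, h2]
  · simp only [IntExp.cost]
    omega

/-- Records the set at the head if it covers all the points. -/
def recordHead : Program :=
  .seq (.setVar vOk (.const 1))
    (.seq checkFlags (.ifElse (positive (.var vOk)) (.setVar vSol (.var vHeadM)) .skip))

def advanceHead : Program :=
  .seq (.setVar vHead (.add (.var vHead) (.const 1)))
    (.seq (.setVar vHeadM (.add (.var vHeadM) (.var vM)))
      (.setVar vHeadN (.add (.var vHeadN) (.var 0))))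

def tryItems : Program := .forLoop vF (.var vM) tryItem

def processHead : Program := .seq recordHead (.seq tryItems advanceHead)

end CoverProgram

namespace StripTask

theorem SearchState.congr {S : StripTask} {c t : ℕ} {A : ℕ → Finset ℕ} {l : ℕ → ℕ} {s s' : Store}
    (h : S.SearchState c A l t s)
    (hs : ∀ a ∈ [vTail, vTailM, vTailN, vStamp, aSet, aFlag, aVis], s'.int a = s.int a) :
    S.SearchState c A l t s' := by
  obtain ⟨h1, h2, h3, h4, h5, h6, h7, h8, h9⟩ := h
  simp only [List.mem_cons, List.not_mem_nil, or_false, forall_eq_or_imp, forall_eq] at hs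
  obtain ⟨g1, g2, g3, g4, g5, g6, g7⟩ := hs
  exact ⟨h1, by rwa [g1], by rwa [g2], by rwa [g3], by rwa [g5], by rwa [g6], by rwa [g4],
    by rwa [g7], by rwa [g7]⟩

/-- The search has processed the first `h` sets; the variable `vSol` points at one of them that
covers all the points, if there is one. -/
structure Searching (S : StripTask) (c : ℕ) (A : ℕ → Finset ℕ) (l : ℕ → ℕ) (t h : ℕ) (s : Store) :
    Prop where
  state : S.SearchState c A l t s
  le : h ≤ t
  head : s.int vHead 0 = h
  headM : s.int vHeadM 0 = h * (S.m * S.K)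
  headN : s.int vHeadN 0 = h * S.n
  closed : ∀ q < h, ∀ f < S.m * S.K, S.Extends (A q) f → S.Represented A l t (A q) f
  sol : (∃ q < h, ∀ p < S.n, S.CoveredBy (A q) p) →
    ∃ q < h, s.int vSol 0 = q * (S.m * S.K) ∧ ∀ p < S.n, S.CoveredBy (A q) p

end StripTask

namespace CoverProgram

open StripTask

theorem recordHead_runs {S : StripTask} {s : Store} (hS : S.HeldBy s) {c h t : ℕ}
    {A : ℕ → Finset ℕ} {l : ℕ → ℕ} (hs : S.Searching c A l t h s) (hlt : h < t) :
    Runs recordHead s (70 * (S.n + 1)) fun s' =>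
      ((∃ q < h + 1, ∀ p < S.n, S.CoveredBy (A q) p) →
        ∃ q < h + 1, s'.int vSol 0 = q * (S.m * S.K) ∧ ∀ p < S.n, S.CoveredBy (A q) p) := by
  refine (Runs.seq_of (Runs.of_loopFree rfl s) fun s₁ hs₁ hrun₁ => Runs.seq_of
    (checkFlags_runs (hS.of_sameOff hs₁ rfl) (h := h * S.n) (by rw [hs₁.int _ rfl, hs.headN]))
    fun s₂ hs₂ hok => Runs.run_of (T := 10) rfl (by decide) (Q := fun s' =>
      ((∃ q < h + 1, ∀ p < S.n, S.CoveredBy (A q) p) →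
        ∃ q < h + 1, s'.int vSol 0 = q * (S.m * S.K) ∧ ∀ p < S.n, S.CoveredBy (A q) p)) ?_).mono
    ?_ fun _ _ h => h
  · have hok' : 0 < s₂.int vOk 0 ↔ ∀ p < S.n, S.CoveredBy (A h) p := by
      rw [hok, hrun₁]
      simp only [Program.run, IntExp.eval, Store.setInt_int_self, Function.update_self,
        Nat.zero_lt_one, true_and, ne_eq, Nat.reduceEqDiff, not_false_eq_true,
        Store.setInt_int_of_ne]
      exact forall₂_congr fun p hp => hs.state.flag h hlt p hp
    by_cases hc : ∀ p < S.n, S.CoveredBy (A h) p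
    · refine fun _ => ⟨h, by omega, ?_, hc⟩
      have h1 : s₂.int vHeadM 0 = h * (S.m * S.K) := by rw [hs₂.int _ rfl, hs₁.int _ rfl, hs.headM]
      have h2 : (positive (.var vOk)).Holds s₂ := hok'.2 hc
      simp [h2, h1]
    · rintro ⟨q, hq, hqc⟩
      have hqh : q < h := by
        rcases Nat.lt_succ_iff_lt_or_eq.1 hq with hq | rfl
        · exact hq
        · exact absurd hqc hc
      obtain ⟨r, hr, hsol, hrc⟩ := hs.sol ⟨q, hqh, hqc⟩
      refine ⟨r, by omega, ?_, hrc⟩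
      have h1 : s₂.int vSol 0 = s.int vSol 0 := by rw [hs₂.int _ rfl, hs₁.int _ rfl]
      have h2 : ¬ 0 < s₂.int vOk 0 := by rwa [hok']
      simp only [Program.run, holds_positive, IntExp.eval, h2, if_false, h1, hsol]
  · simp only [Program.maxCost, IntExp.cost]
    omega

/-- The queue grows during the loop, but `Prolongs` freezes the sets already present, so the head
set stays the same and an extension once represented stays represented. -/
theorem tryItems_runs {S : StripTask} {s : Store} (hS : S.HeldBy s) {c h t : ℕ}
    {A : ℕ → Finset ℕ} {l : ℕ → ℕ} (hs : S.SearchState c A l t s) (hh : h < t)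
    (hM : s.int vHeadM 0 = h * (S.m * S.K)) (hN : s.int vHeadN 0 = h * S.n) :
    Runs tryItems s (520 * (S.m * S.K + 1) * (S.m * S.K + S.n + 1)) fun s' =>
      ∃ A' l' t', S.SearchState c A' l' t' s' ∧ Prolongs A l t A' l' t' ∧
        ∀ f < S.m * S.K, S.Extends (A h) f → S.Represented A' l' t' (A h) f := by
  refine (Runs.forLoop (S.m * S.K) (500 * (S.m * S.K + S.n + 1)) (fun j s' =>
      ∃ A' l' t', S.SearchState c A' l' t' s' ∧ Prolongs A l t A' l' t' ∧
        ∀ f < j, S.Extends (A h) f → S.Represented A' l' t' (A h) f)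
      ?_ rfl ?_ ?_).mono ?_ fun _ _ h => h
  · intro s' hs'
    exact (hS.of_sameOff hs' rfl).M
  · exact ⟨A, l, t, hs.congr (by simp), Prolongs.refl _ _ _, by simp⟩
  · rintro j s' hj hs' hv ⟨A', l', t', hstate, hpro, hrep⟩
    have hAh := (hpro.2 h hh).1
    refine (tryItem_runs (hS.of_sameOff hs' rfl) hstate hv hj (hh.trans_le hpro.1)
      (by rw [hs'.int _ rfl, hM]) (by rw [hs'.int _ rfl, hN])).mono le_rfl ?_
    rintro s'' - ⟨A'', l'', t'', hstate', hpro', hrep'⟩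
    refine ⟨A'', l'', t'', hstate'.congr (by simp), hpro.trans hpro', ?_⟩
    intro f hf
    rcases Nat.lt_succ_iff_lt_or_eq.1 hf with hf | rfl
    · exact fun hext => (hrep f hf hext).mono hpro'
    · rwa [hAh] at hrep'
  · simp only [IntExp.cost]
    have h1 : S.m * S.K ≤ S.m * S.K * (S.m * S.K + S.n + 1) := Nat.le_mul_of_pos_right _ (by omega)
    have h2 : 1 ≤ S.m * S.K + S.n + 1 := by omega
    generalize S.m * S.K + S.n + 1 = X at *
    nlinarith

theorem processHead_runs {S : StripTask} {s : Store} (hS : S.HeldBy s) {c h t : ℕ}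
    {A : ℕ → Finset ℕ} {l : ℕ → ℕ} (hs : S.Searching c A l t h s) (hlt : h < t) :
    Runs processHead s (650 * (S.m * S.K + 1) * (S.m * S.K + S.n + 1)) fun s' =>
      ∃ A' l' t', S.Searching c A' l' t' (h + 1) s' := by
  refine (Runs.seq_of (recordHead_runs hS hs hlt) fun s₁ hs₁ hsol => Runs.seq_of (T' := 20)
    (tryItems_runs (hS.of_sameOff hs₁ rfl)
      (hs.state.congr fun a ha => hs₁.int _ (by fin_cases ha <;> rfl)) hlt
      (by rw [hs₁.int _ rfl, hs.headM]) (by rw [hs₁.int _ rfl, hs.headN]))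
    fun s₂ hs₂ ⟨A', l', t', hstate, hpro, hrep⟩ => Runs.run_of rfl (by decide)
      (Q := fun s' => ∃ A' l' t', S.Searching c A' l' t' (h + 1) s') ?_).mono ?_ fun _ _ h => h
  · have hh : s₂.int vHead 0 = h := by rw [hs₂.int _ rfl, hs₁.int _ rfl, hs.head]
    have hM : s₂.int vHeadM 0 = h * (S.m * S.K) := by rw [hs₂.int _ rfl, hs₁.int _ rfl, hs.headM]
    have hN : s₂.int vHeadN 0 = h * S.n := by rw [hs₂.int _ rfl, hs₁.int _ rfl, hs.headN]
    have hvM : s₂.int vM 0 = S.m * S.K := by rw [hs₂.int _ rfl, hs₁.int _ rfl, hS.M]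
    have hvN : s₂.int 0 0 = S.n := by rw [hs₂.int _ rfl, hs₁.int _ rfl, hS.n]
    have hA : ∀ q < h + 1, A' q = A q := fun q hq => (hpro.2 q (by omega)).1
    refine ⟨A', l', t', hstate.congr (by simp [advanceHead]), by have := hpro.1; omega,
      by simp [advanceHead, hh], by simp [advanceHead, hM, hvM, Nat.succ_mul],
      by simp [advanceHead, hN, hvN, Nat.succ_mul], ?_, ?_⟩
    · intro q hq f hf hext
      rw [hA q hq] at hext ⊢
      rcases Nat.lt_succ_iff_lt_or_eq.1 hq with hq | rfl
      · exact (hs.closed q hq f hf hext).mono hpro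
      · exact hrep f hf hext
    · rintro ⟨q, hq, hqc⟩
      rw [hA q hq] at hqc
      obtain ⟨r, hr, hr', hrc⟩ := hsol ⟨q, hq, hqc⟩
      refine ⟨r, hr, ?_, by rwa [hA r hr]⟩
      rw [← hr', ← hs₂.int vSol rfl]
      simp [advanceHead]
  · have h1 : S.m * S.K + S.n + 1 ≤ (S.m * S.K + 1) * (S.m * S.K + S.n + 1) :=
      Nat.le_mul_of_pos_left _ (by omega)
    rw [mul_assoc, mul_assoc]
    generalize (S.m * S.K + 1) * (S.m * S.K + S.n + 1) = X at *
    omega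

/-- The point `vP` is one of those in the strip. -/
def needTest : Test :=
  .and (.intLe (.get aDone (.var vP)) (.const 0))
    (.not (.realLe (.add (.get 4 (.const 0)) (.const (7 / 5))) pointY))

/-- Starts the search with the empty set. -/
def initSearch : Program :=
  .seq (.forLoop vE (.var vM) (.setInt aSet (.var vE) (.const 0)))
    (.seq (.forLoop vP (.var 0) (.ifElse needTest (.setInt aFlag (.var vP) (.const 0))
        (.setInt aFlag (.var vP) (.const 1))))
      (.seq (.setVar vHead (.const 0)) (.seq (.setVar vHeadM (.const 0))
        (.seq (.setVar vHeadN (.const 0)) (.seq (.setVar vTail (.const 1))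
        (.seq (.setVar vTailM (.var vM)) (.setVar vTailN (.var 0))))))))

theorem holds_needTest {S : StripTask} {s : Store} (hS : S.HeldBy s) :
    needTest.Holds s ↔ s.int aDone (s.int vP 0) = 0 ∧ S.py (s.int vP 0) < S.y₀ + 7 / 5 := by
  simp [needTest, Test.Holds, hS.py, hS.y₀]

/-- A stamp larger than every entry makes the table `aVis` count as empty, so it is never cleared
between strips. -/
theorem initSearch_runs {S : StripTask} {s : Store} (hS : S.HeldBy s) {c : ℕ}
    (hneed : ∀ p < S.n, S.need p ↔ s.int aDone p = 0 ∧ S.py p < S.y₀ + 7 / 5)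
    (hc : s.int vStamp 0 = c) (hvis : ∀ κ, s.int aVis κ < c) :
    Runs initSearch s (100 * (S.m * S.K + S.n + 1)) fun s' =>
      S.Searching c (fun _ => ∅) (fun _ => 0) 1 0 s' := by
  have hset : Runs (.forLoop vE (.var vM) (.setInt aSet (.var vE) (.const 0))) s
      (S.m * S.K * (4 + 2 + 10) + 2 + 10) fun s' => ∀ e < S.m * S.K, s'.int aSet e = 0 := by
    refine Runs.forLoop (S.m * S.K) 4 (fun j s' => ∀ e < j, s'.int aSet e = 0) ?_ rfl (by simp) ?_
    · intro s' hs'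
      exact (hS.of_sameOff hs' rfl).M
    · rintro j s' hj hs' hv h1
      refine Runs.run_of rfl (by decide) ?_
      intro e he
      rcases Nat.lt_succ_iff_lt_or_eq.1 he with he | rfl
      · simpa [hv, Function.update_apply] using fun _ => h1 e he
      · simp [hv]
  refine (Runs.seq_of hset fun s₁ hs₁ hset₁ => Runs.seq_of (T' := 40)
    (Q' := fun s' => ∀ p < S.n, 0 < s'.int aFlag p ↔ S.CoveredBy ∅ p)
    (Runs.forLoop S.n 30 (fun j s' => ∀ p < j, 0 < s'.int aFlag p ↔ S.CoveredBy ∅ p)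
      ?_ rfl (by simp) ?_) fun s₂ hs₂ hflag => Runs.run_of rfl (by decide)
      (Q := fun s' => S.Searching c (fun _ => ∅) (fun _ => 0) 1 0 s') ?_).mono ?_ fun _ _ h => h
  · intro s' hs'
    exact ((hS.of_sameOff hs₁ rfl).of_sameOff hs' rfl).n
  · rintro j s' hj hs' hv h1
    have hS' := (hS.of_sameOff hs₁ rfl).of_sameOff hs' rfl
    refine Runs.run_of rfl (by decide) ?_
    have h2 := holds_needTest hS'
    rw [hv, hs'.int aDone rfl, hs₁.int aDone rfl, ← hneed j hj] at h2
    intro p hp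
    rcases Nat.lt_succ_iff_lt_or_eq.1 hp with hp | rfl
    · by_cases h3 : S.need j <;> simpa [h2, h3, hv, Function.update_apply, hp.ne] using h1 p hp
    · by_cases h3 : S.need p <;> simp [h2, h3, hv, CoveredBy]
  · have hst : s₂.int vStamp 0 = c := by rw [hs₂.int _ rfl, hs₁.int _ rfl, hc]
    have hv : s₂.int aVis = s.int aVis := by rw [hs₂.int _ rfl, hs₁.int _ rfl]
    have hs : s₂.int aSet = s₁.int aSet := by rw [hs₂.int _ rfl]
    have hvM : s₂.int vM 0 = S.m * S.K := by rw [hs₂.int _ rfl, hs₁.int _ rfl, hS.M]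
    have hvN : s₂.int 0 0 = S.n := by rw [hs₂.int _ rfl, hs₁.int _ rfl, hS.n]
    refine ⟨⟨Found.single, by simp, by simp [hvM], by simp [hvN], ?_, ?_, by simpa using hst, ?_,
      ?_⟩, by simp, by simp, by simp, by simp, by simp, by simp⟩
    · intro q hq e he
      obtain rfl : q = 0 := by omega
      simp [hs, hset₁ e he]
    · intro q hq p hp
      obtain rfl : q = 0 := by omega
      simpa using hflag p hp
    · intro κ
      simpa [hv] using (hvis κ).le
    · intro κ
      simp only [Program.run, IntExp.eval, ne_eq, Nat.reduceEqDiff, not_false_eq_true,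
        Store.setInt_int_of_ne, hv]
      refine iff_of_false (hvis κ).ne ?_
      rintro ⟨q, hq, hq0, -⟩
      omega
  · simp only [IntExp.cost]
    omega

/-- Finds a set that solves the task of the strip. -/
def search : Program :=
  .seq initSearch (.loop (.not (.intLe (.var vTail) (.var vHead))) processHead)

/-- Every round advances the head, which stays within the bound of `Found.card_le`. When the head
meets the tail the queue is closed under extensions, and `Found.exists_covering` supplies a covering
set. -/
theorem search_runs {S : StripTask} {s : Store} (hS : S.HeldBy s) {c : ℕ}
    (hneed : ∀ p < S.n, S.need p ↔ s.int aDone p = 0 ∧ S.py p < S.y₀ + 7 / 5)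
    (hc : s.int vStamp 0 = c) (hvis : ∀ κ, s.int aVis κ < c) {F : Finset ℕ} (hF : S.Solution F) :
    Runs search s (2000 * (S.m + 1) ^ (4 * S.K) * ((S.m * S.K + 1) * (S.m * S.K + S.n + 1)))
      fun s' => (∀ κ, s'.int aVis κ ≤ c) ∧ ∃ A, S.Solution A ∧
        ∀ e < S.m * S.K, 0 < s'.int aSet (s'.int vSol 0 + e) ↔ e ∈ A := by
  refine (Runs.seq_of (initSearch_runs hS hneed hc hvis) fun s₁ hs₁ hsearch =>
    (Runs.loop (fun h s' => ∃ A l t, S.Searching c A l t h s') (1 + (S.m + 1) ^ (4 * S.K))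
      (650 * (S.m * S.K + 1) * (S.m * S.K + S.n + 1)) ⟨_, _, _, hsearch⟩ ?_).mono
      le_rfl (Q' := fun s' => (∀ κ, s'.int aVis κ ≤ c) ∧ ∃ A, S.Solution A ∧
        ∀ e < S.m * S.K, 0 < s'.int aSet (s'.int vSol 0 + e) ↔ e ∈ A) ?_).mono ?_ fun _ _ h => h
  · rintro h s' hs' ⟨A, l, t, hI⟩ hb
    have hlt : h < t := by
      simpa [Test.Holds, hI.state.tail, hI.head] using hb
    exact ⟨hlt.trans_le hI.state.found.card_le,
      processHead_runs ((hS.of_sameOff hs₁ rfl).of_sameOff hs' rfl) hI hlt⟩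
  · rintro s' - ⟨h, ⟨A, l, t, hI⟩, hb⟩
    have hle : t ≤ h := by
      simpa [Test.Holds, hI.state.tail, hI.head] using hb
    obtain rfl := le_antisymm hI.le hle
    obtain ⟨q, hq, hsol, hcov⟩ := hI.sol (hI.state.found.exists_covering hI.closed hF)
    refine ⟨hI.state.vis_le, A q, ⟨hI.state.found.independent q hq, hcov⟩, ?_⟩
    rw [hsol]
    exact hI.state.set q hq
  · have hN : 1 ≤ (S.m + 1) ^ (4 * S.K) := Nat.one_le_pow _ _ (by omega)
    simp only [Test.cost, IntExp.cost]
    generalize (S.m + 1) ^ (4 * S.K) = N at *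
    have h1 : S.m * S.K + S.n + 1 ≤ (S.m * S.K + 1) * (S.m * S.K + S.n + 1) :=
      Nat.le_mul_of_pos_left _ (by omega)
    have h2 : 1 ≤ S.m * S.K + S.n + 1 := by omega
    rw [mul_assoc 650]
    generalize (S.m * S.K + 1) * (S.m * S.K + S.n + 1) = B at *
    nlinarith

end CoverProgram

namespace StripTask

/-! ### The sequence of strips -/

/-- The task of the strip that is described by the memory: the strip begins at the height held by
the real variable `4`, and the points that have to be covered are those in the strip that are not
marked. -/
def current (B : StripTask) (s : Store) : StripTask :=
  { B with
    y₀ := s.real 4 0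
    need := fun p => s.int aDone p = 0 ∧ B.py p < s.real 4 0 + 7 / 5 }

def keepsInput (p : Program) : Bool :=
  !(p.writesInt 0 || p.writesInt vM || p.writesInt aDisk || p.writesInt aCol || p.writesInt aPow
    || p.writesReal 0 || p.writesReal 1 || p.writesReal 2 || p.writesReal 3)

theorem HeldBy.current_of_sameOff {B : StripTask} {p : Program} {s s' : Store}
    (h : (B.current s).HeldBy s) (hs : SameOff p s s') (hp : keepsInput p = true) :
    (B.current s').HeldBy s' := by
  simp only [keepsInput, Bool.not_eq_true', Bool.or_eq_false_iff] at hp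
  obtain ⟨⟨⟨⟨⟨⟨⟨⟨h0, h1⟩, h2⟩, h3⟩, h4⟩, h5⟩, h6⟩, h7⟩, h8⟩ := hp
  obtain ⟨g0, g1, g2, g3, g4, g5, g6, g7, g8, -⟩ := h
  exact ⟨by rw [hs.int _ h0]; exact g0, by rw [hs.int _ h1]; exact g1,
    by rw [hs.int _ h2]; exact g2, by rw [hs.int _ h3]; exact g3, by rw [hs.int _ h4]; exact g4,
    by rw [hs.real _ h5]; exact g5, by rw [hs.real _ h6]; exact g6, by rw [hs.real _ h7]; exact g7,
    by rw [hs.real _ h8]; exact g8, rfl⟩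

/-- The items of `G` form packings that cover all the points. -/
structure Cover (B : StripTask) (G : Finset ℕ) : Prop where
  lt : ∀ e ∈ G, e < B.m * B.K
  not_conflict : ∀ e ∈ G, ∀ f ∈ G, e ≠ f → ¬ B.Conflict e f
  covers : ∀ p < B.n, ∃ e ∈ G, B.Covers e p

theorem Covers.abs_le {S : StripTask} {e p : ℕ} (h : S.Covers e p) : |S.py p - S.y e| ≤ 1 := by
  unfold Covers at h
  exact abs_le_of_sq_le_sq (by nlinarith [mul_self_nonneg (S.px p - S.x e)]) zero_le_one

/-- Restrict the global cover to the relevant items: a needed point has a height in [y₀, y₀ + 7/5),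
and its disk has its centre within vertical distance 1. -/
theorem Cover.exists_solution {B : StripTask} {G : Finset ℕ} (hG : B.Cover G) {s : Store}
    (hmin : ∀ p < B.n, s.int aDone p = 0 → s.real 4 0 ≤ B.py p) :
    ∃ F, (B.current s).Solution F := by
  classical
  refine ⟨G.filter (B.current s).Relevant, ⟨fun e he => hG.lt e (Finset.mem_filter.1 he).1,
    fun e he => (Finset.mem_filter.1 he).2, fun e he f hf => hG.not_conflict e
    (Finset.mem_filter.1 he).1 f (Finset.mem_filter.1 hf).1⟩, ?_⟩
  rintro p hp ⟨hdone, hlt⟩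
  obtain ⟨e, he, hep⟩ := hG.covers p hp
  refine ⟨e, Finset.mem_filter.2 ⟨he, ?_⟩, hep⟩
  have h1 := abs_le.1 hep.abs_le
  have h2 := hmin p hp hdone
  constructor
  · change s.real 4 0 - 1 ≤ B.y e
    linarith
  · change B.y e ≤ s.real 4 0 + 12 / 5
    linarith

/-- A sequence of strips. -/
structure Strips (B : StripTask) (Y : ℕ → ℝ) (j : ℕ) : Prop where
  gap : ∀ i' < j, ∀ i < i', Y i + 7 / 5 * ((i' : ℝ) - i) ≤ Y i'
  point : ∀ i < j, ∃ p < B.n, Y i = B.py p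

/-- Distinct strips begin at distinct points. -/
theorem Strips.le_n {B : StripTask} {Y : ℕ → ℝ} {j : ℕ} (h : B.Strips Y j) : j ≤ B.n := by
  choose! p hp hY using h.point
  have := Finset.card_le_card_of_injOn (s := Finset.range j) (t := Finset.range B.n) p
    (fun i hi => Finset.mem_range.2 (hp i (Finset.mem_range.1 hi))) ?_
  · simpa using this
  have key : ∀ i' < j, ∀ i < i', p i ≠ p i' := by
    intro i' hi' i hi heq
    have h1 := h.gap i' hi' i hi
    rw [hY i (hi.trans hi'), hY i' hi', heq] at h1
    have : (i : ℝ) < i' := by exact_mod_cast hi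
    linarith
  intro i hi i' hi' heq
  have hi := Finset.mem_range.1 hi
  have hi' := Finset.mem_range.1 hi'
  rcases lt_trichotomy i i' with hlt | rfl | hlt
  · exact absurd heq (key i' hi' i hlt)
  · rfl
  · exact absurd heq.symm (key i hi i' hlt)

/-- Strips of equal parity begin at least 14/5 > 2 apart, so no disk contains the initial points of
two of them; the parity and a disk covering the initial point determine the strip. -/
theorem Strips.le_m {B : StripTask} {Y : ℕ → ℝ} {j : ℕ} (h : B.Strips Y j) {G : Finset ℕ}
    (hG : B.Cover G) : j ≤ 2 * B.m := by
  have hex : ∀ i < j, ∃ d < B.m, |Y i - B.dy d| ≤ 1 := by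
    intro i hi
    obtain ⟨p, hp, hY⟩ := h.point i hi
    obtain ⟨e, he, hep⟩ := hG.covers p hp
    have hlt := hG.lt e he
    have hm : 0 < B.m := Nat.pos_of_ne_zero (by rintro h; simp [h] at hlt)
    exact ⟨e % B.m, Nat.mod_lt _ hm, by rw [hY]; exact hep.abs_le⟩
  choose! d hd hY using hex
  have := Finset.card_le_card_of_injOn (s := Finset.range j)
    (t := Finset.range 2 ×ˢ Finset.range B.m) (fun i => (i % 2, d i))
    (fun i hi => Finset.mem_product.2
      ⟨Finset.mem_range.2 (Nat.mod_lt i two_pos),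
        Finset.mem_range.2 (hd i (Finset.mem_range.1 hi))⟩) ?_
  · simpa using this
  have key : ∀ i' < j, ∀ i < i', ¬ (i % 2 = i' % 2 ∧ d i = d i') := by
    rintro i' hi' i hi ⟨hpar, heq⟩
    have h1 := h.gap i' hi' i hi
    have h2 : i + 2 ≤ i' := by omega
    have h3 : (i : ℝ) + 2 ≤ i' := by exact_mod_cast h2
    have h4 := abs_le.1 (hY i (hi.trans hi'))
    have h5 := abs_le.1 (hY i' hi')
    rw [heq] at h4
    linarith
  intro i hi i' hi' heq
  have hi := Finset.mem_range.1 hi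
  have hi' := Finset.mem_range.1 hi'
  obtain ⟨h1, h2⟩ := Prod.mk.inj heq
  rcases lt_trichotomy i i' with hlt | rfl | hlt
  · exact absurd ⟨h1, h2⟩ (key i' hi' i hlt)
  · rfl
  · exact absurd ⟨h1.symm, h2.symm⟩ (key i hi i' hlt)

/-- The variable `vFound` tells whether there is an unmarked point, and the strip begins at the
lowest such point. -/
structure Selected (B : StripTask) (s : Store) : Prop where
  found : 0 < s.int vFound 0 ↔ ∃ p < B.n, s.int aDone p = 0
  point : 0 < s.int vFound 0 → ∃ p < B.n, s.int aDone p = 0 ∧ s.real 4 0 = B.py p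
  le : ∀ p < B.n, s.int aDone p = 0 → s.real 4 0 ≤ B.py p

/-- The output for `j` strips, which begin at the heights `Y i` and are covered by the sets `A i`
of items. -/
structure Written (B : StripTask) (Y : ℕ → ℝ) (A : ℕ → Finset ℕ) (j : ℕ) (out : ℕ → ℕ) : Prop where
  independent : ∀ i < j, ({ B with y₀ := Y i } : StripTask).Independent (A i)
  pos : ∀ i < j, ∀ e ∈ A i, 0 < out (e % B.m)
  color : ∀ d < B.m, 0 < out d →
    ∃ i < j, ∃ e ∈ A i, e % B.m = d ∧ out d = i % 4 * B.K + e / B.m + 1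

/-- The memory after `j` strips have been processed. -/
structure Progress (B : StripTask) (Y : ℕ → ℝ) (A : ℕ → Finset ℕ) (j : ℕ) (s : Store) : Prop where
  held : (B.current s).HeldBy s
  selected : B.Selected s
  strips : B.Strips Y j
  written : B.Written Y A j (s.int 1)
  undone : ∀ p < B.n, s.int aDone p = 0 → ∀ i < j, Y i + 7 / 5 * ((j : ℝ) - i) ≤ B.py p
  done : ∀ p < B.n, s.int aDone p ≠ 0 → ∃ i < j, ∃ e ∈ A i, B.Covers e p
  K : s.int vK 0 = B.K
  off : s.int vOff 0 = j % 4 * B.K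
  stamp : s.int vStamp 0 = j
  vis_le : ∀ κ, s.int aVis κ ≤ j

theorem Progress.strips_succ {B : StripTask} {Y : ℕ → ℝ} {A : ℕ → Finset ℕ} {j : ℕ} {s : Store}
    (h : B.Progress Y A j s) (hf : 0 < s.int vFound 0) :
    B.Strips (Function.update Y j (s.real 4 0)) (j + 1) := by
  obtain ⟨p, hp, hdone, hY⟩ := h.selected.point hf
  constructor
  · intro i' hi' i hi
    rcases Nat.lt_succ_iff_lt_or_eq.1 hi' with hi' | rfl
    · simpa [hi'.ne, (hi.trans hi').ne] using h.strips.gap i' hi' i hi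
    · simpa [hi.ne, hY] using h.undone p hp hdone i hi
  · intro i hi
    rcases Nat.lt_succ_iff_lt_or_eq.1 hi with hi | rfl
    · simpa [hi.ne] using h.strips.point i hi
    · exact ⟨p, hp, by simp [hY]⟩

end StripTask

namespace CoverProgram

open StripTask

attribute [local simp] holds_positive

/-- The point `vP` is not marked and lower than the points considered so far. -/
def lowerTest : Test :=
  .and (.intLe (.get aDone (.var vP)) (.const 0))
    (.not (.and (positive (.var vFound)) (.realLe (.get 4 (.const 0)) pointY)))

/-- Finds the lowest unmarked point. -/
def select : Program :=
  .seq (.setVar vFound (.const 0))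
    (.forLoop vP (.var 0) (.ifElse lowerTest
      (.seq (.setReal 4 (.const 0) pointY) (.setVar vFound (.const 1))) .skip))

theorem select_runs {B : StripTask} {s : Store} (hn : s.int 0 0 = B.n) (hpy : s.real 1 = B.py) :
    Runs select s (60 * (B.n + 1)) B.Selected := by
  refine (Runs.seq_of (Runs.of_loopFree rfl s) fun s₁ hs₁ hrun => (Runs.forLoop B.n 35 (fun j s' =>
    (0 < s'.int vFound 0 ↔ ∃ p < j, s.int aDone p = 0) ∧
    (0 < s'.int vFound 0 → ∃ p < j, s.int aDone p = 0 ∧ s'.real 4 0 = B.py p) ∧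
    (∀ p < j, s.int aDone p = 0 → s'.real 4 0 ≤ B.py p)) ?_ rfl ?_ ?_).mono le_rfl
    (Q' := B.Selected) ?_).mono ?_ fun _ _ h => h
  · intro s' hs'
    change s'.int 0 0 = _
    rw [hs'.int _ rfl, hs₁.int _ rfl, hn]
  · subst hrun
    simp
  · rintro j s' hj hs' hv ⟨h1, h2, h3⟩
    have hdone : s'.int aDone = s.int aDone := by rw [hs'.int _ rfl, hs₁.int _ rfl]
    have hpy' : s'.real 1 = B.py := by rw [hs'.real _ rfl, hs₁.real _ rfl, hpy]
    have htest : lowerTest.Holds s' ↔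
        s.int aDone j = 0 ∧ (0 < s'.int vFound 0 → B.py j < s'.real 4 0) := by
      simp [lowerTest, Test.Holds, hv, hdone, hpy', Nat.succ_le_iff]
    refine Runs.run_of rfl (by decide) ?_
    by_cases h4 : lowerTest.Holds s'
    · rw [htest] at h4
      have hle : ∀ p < j, s.int aDone p = 0 → B.py j ≤ B.py p := fun p hp hd =>
        (h4.2 (h1.2 ⟨p, hp, hd⟩)).le.trans (h3 p hp hd)
      simp only [Program.run, htest, h4.1, true_and, if_pos h4.2]
      refine ⟨by simpa using ⟨j, le_rfl, h4.1⟩, fun _ => ⟨j, by omega, h4.1, by simp [hv, hpy']⟩,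
        fun p hp hd => ?_⟩
      rcases Nat.lt_succ_iff_lt_or_eq.1 hp with hp | rfl
      · simpa [hv, hpy'] using hle p hp hd
      · simp [hv, hpy']
    · simp only [Program.run, h4, if_false]
      rw [htest, not_and, Classical.not_imp, not_lt] at h4
      have hex : (∃ p < j + 1, s.int aDone p = 0) ↔ ∃ p < j, s.int aDone p = 0 := by
        constructor
        · rintro ⟨p, hp, hd⟩
          rcases Nat.lt_succ_iff_lt_or_eq.1 hp with hp | rfl
          · exact ⟨p, hp, hd⟩
          · exact h1.1 (h4 hd).1
        · rintro ⟨p, hp, hd⟩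
          exact ⟨p, by omega, hd⟩
      refine ⟨by rw [hex]; simpa using h1, fun hf => ?_, fun p hp hd => ?_⟩
      · obtain ⟨p, hp, hd, hy⟩ := h2 (by simpa using hf)
        exact ⟨p, by omega, hd, by simpa using hy⟩
      · rcases Nat.lt_succ_iff_lt_or_eq.1 hp with hp | rfl
        · simpa using h3 p hp hd
        · simpa using (h4 hd).2
  · rintro s' hs' ⟨h1, h2, h3⟩
    have hdone : s'.int aDone = s.int aDone := by rw [hs'.int _ rfl, hs₁.int _ rfl]
    exact ⟨by rwa [hdone], by rwa [hdone], by rwa [hdone]⟩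
  · simp only [Program.maxCost, IntExp.cost]
    omega

end CoverProgram

namespace CoverProgram

open StripTask

attribute [local simp] holds_positive

/-! ### The whole program -/

/-- Colours the disks of the solution of the strip. -/
def writeOutput : Program :=
  .forLoop vE (.var vM) (.ifElse (positive (.get aSet (.add (.var vSol) (.var vE))))
    (.setInt 1 (.get aDisk (.var vE)) (.add (.add (.var vOff) (.get aCol (.var vE))) (.const 1)))
    .skip)

/-- A disk may occur with several colours or in several strips; the last write wins. This is
harmless, since only two facts are needed: the disk remains selected, and its final colour comes
from some item of some strip. The added 1 keeps colours distinct from the value 0 of an unselected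
disk. -/
theorem writeOutput_runs {S : StripTask} {s : Store} (hS : S.HeldBy s) {Y : ℕ → ℝ}
    {A : ℕ → Finset ℕ} {C : Finset ℕ} {j : ℕ} (hout : S.Written Y A j (s.int 1))
    (hC : S.Independent C) (hset : ∀ e < S.m * S.K, 0 < s.int aSet (s.int vSol 0 + e) ↔ e ∈ C)
    (hoff : s.int vOff 0 = j % 4 * S.K) :
    Runs writeOutput s (60 * (S.m * S.K + 1)) fun s' =>
      S.Written (Function.update Y j S.y₀) (Function.update A j C) (j + 1) (s'.int 1) := by
  refine (Runs.forLoop (S.m * S.K) 40 (fun i s' =>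
      (∀ d, 0 < s.int 1 d → 0 < s'.int 1 d) ∧ (∀ e ∈ C, e < i → 0 < s'.int 1 (e % S.m)) ∧
      ∀ d, s'.int 1 d = s.int 1 d ∨
        ∃ e ∈ C, e % S.m = d ∧ s'.int 1 d = j % 4 * S.K + e / S.m + 1) ?_ rfl ?_ ?_).mono ?_ ?_
  · intro s' hs'
    exact (hS.of_sameOff hs' rfl).M
  · simp
  · rintro i s' hi hs' hv ⟨h1, h2, h3⟩
    have hS' := hS.of_sameOff hs' rfl
    have hset' : s'.int aSet (s'.int vSol 0 + i) = s.int aSet (s.int vSol 0 + i) := by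
      rw [hs'.int aSet rfl, hs'.int vSol rfl]
    have hoff' : s'.int vOff 0 = j % 4 * S.K := by rw [hs'.int _ rfl, hoff]
    refine Runs.run_of rfl (by decide) ?_
    by_cases hiC : i ∈ C
    · have hpos := (hset i hi).2 hiC
      have hrun : ((Program.ifElse (positive (.get aSet (.add (.var vSol) (.var vE))))
          (.setInt 1 (.get aDisk (.var vE))
            (.add (.add (.var vOff) (.get aCol (.var vE))) (.const 1))) .skip).run s').int 1 =
          Function.update (s'.int 1) (i % S.m) (j % 4 * S.K + i / S.m + 1) := by
        simp [hv, hset', hpos, hS'.disk i hi, hS'.col i hi, hoff']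
      simp only [ne_eq, Nat.reduceEqDiff, not_false_eq_true, Store.setInt_int_of_ne, hrun]
      refine ⟨fun d hd => ?_, fun e he hei => ?_, fun d => ?_⟩
      · rcases eq_or_ne d (i % S.m) with rfl | hne
        · simp
        · simpa [hne] using h1 d hd
      · rcases eq_or_ne (e % S.m) (i % S.m) with heq | hne
        · simp [heq]
        · rw [Function.update_of_ne hne]
          exact h2 e he (lt_of_le_of_ne (Nat.lt_succ_iff.1 hei) (by rintro rfl; exact hne rfl))
      · rcases eq_or_ne d (i % S.m) with rfl | hne
        · exact Or.inr ⟨i, hiC, rfl, by simp⟩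
        · simpa [hne] using h3 d
    · have hpos : ¬ 0 < s.int aSet (s.int vSol 0 + i) := fun h => hiC ((hset i hi).1 h)
      have hrun : ((Program.ifElse (positive (.get aSet (.add (.var vSol) (.var vE))))
          (.setInt 1 (.get aDisk (.var vE))
            (.add (.add (.var vOff) (.get aCol (.var vE))) (.const 1))) .skip).run s') = s' := by
        simp only [Program.run, holds_positive, IntExp.eval, hv, hset', hpos, if_false]
      rw [hrun]
      simp only [ne_eq, Nat.reduceEqDiff, not_false_eq_true, Store.setInt_int_of_ne]
      refine ⟨h1, fun e he hei => h2 e he (lt_of_le_of_ne (Nat.lt_succ_iff.1 hei) ?_), h3⟩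
      rintro rfl
      exact hiC he
  · simp only [IntExp.cost]
    omega
  · rintro s' - ⟨h1, h2, h3⟩
    refine ⟨fun i hi => ?_, fun i hi e he => ?_, fun d hd hpos => ?_⟩
    · rcases Nat.lt_succ_iff_lt_or_eq.1 hi with hi | rfl
      · simpa [hi.ne] using hout.independent i hi
      · simpa using hC
    · rcases Nat.lt_succ_iff_lt_or_eq.1 hi with hi | rfl
      · rw [Function.update_of_ne hi.ne] at he
        exact h1 _ (hout.pos i hi e he)
      · rw [Function.update_self] at he
        exact h2 e he (hC.lt e he)
    · rcases h3 d with h4 | ⟨e, he, hed, h4⟩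
      · rw [h4] at hpos
        obtain ⟨i, hi, e, he, hed, h5⟩ := hout.color d hd hpos
        exact ⟨i, by omega, e, by rwa [Function.update_of_ne hi.ne], hed, by rw [h4, h5]⟩
      · exact ⟨j, by omega, e, by rwa [Function.update_self], hed, h4⟩

/-- Marks the points of the strip. -/
def markPoints : Program :=
  .forLoop vP (.var 0) (.ifElse needTest (.setInt aDone (.var vP) (.const 1)) .skip)

theorem markPoints_runs {B : StripTask} {s : Store} (hS : (B.current s).HeldBy s) :
    Runs markPoints s (50 * (B.n + 1)) fun s' => ∀ p < B.n,
      s'.int aDone p = 0 ↔ s.int aDone p = 0 ∧ s.real 4 0 + 7 / 5 ≤ B.py p := by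
  refine (Runs.forLoop B.n 30 (fun j s' => (∀ p < j,
      s'.int aDone p = 0 ↔ s.int aDone p = 0 ∧ s.real 4 0 + 7 / 5 ≤ B.py p) ∧
      ∀ p, j ≤ p → s'.int aDone p = s.int aDone p) ?_ rfl ?_ ?_).mono ?_ ?_
  · intro s' hs'
    exact (hS.of_sameOff hs' rfl).n
  · simp
  · rintro j s' hj hs' hv ⟨h1, h2⟩
    have hS' := hS.of_sameOff hs' rfl
    have htest := holds_needTest hS'
    rw [hv, h2 j le_rfl] at htest
    change _ ↔ _ ∧ B.py j < s.real 4 0 + 7 / 5 at htest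
    refine Runs.run_of rfl (by decide) ?_
    by_cases h3 : s.int aDone j = 0 ∧ B.py j < s.real 4 0 + 7 / 5
    · have hrun : ((Program.ifElse needTest (.setInt aDone (.var vP) (.const 1)) .skip).run s').int
          aDone = Function.update (s'.int aDone) j 1 := by
        simp [htest, h3, hv]
      simp only [ne_eq, Nat.reduceEqDiff, not_false_eq_true, Store.setInt_int_of_ne, hrun]
      refine ⟨fun p hp => ?_, fun p hp => ?_⟩
      · rcases Nat.lt_succ_iff_lt_or_eq.1 hp with hp | rfl
        · rw [Function.update_of_ne hp.ne, h1 p hp]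
        · simp [h3.2]
      · rw [Function.update_of_ne (by omega), h2 p (by omega)]
    · have hrun : (Program.ifElse needTest (.setInt aDone (.var vP) (.const 1)) .skip).run s' =
          s' := by
        simp only [Program.run, htest, h3, if_false]
      rw [hrun]
      simp only [ne_eq, Nat.reduceEqDiff, not_false_eq_true, Store.setInt_int_of_ne]
      refine ⟨fun p hp => ?_, fun p hp => h2 p (by omega)⟩
      rcases Nat.lt_succ_iff_lt_or_eq.1 hp with hp | rfl
      · exact h1 p hp
      · rw [h2 p le_rfl]
        rw [not_and, not_lt] at h3
        exact ⟨fun h => ⟨h, h3 h⟩, fun h => h.1⟩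
  · simp only [IntExp.cost]
    omega
  · rintro s' - ⟨h1, -⟩
    exact h1

def nextOffset : Program :=
  .seq (.setVar vOff (.add (.var vOff) (.var vK)))
    (.ifElse (.intLe (.add (.add (.var vK) (.var vK)) (.add (.var vK) (.var vK))) (.var vOff))
      (.setVar vOff (.const 0)) .skip)

/-- The offset cycles through 0, K, 2K, 3K by addition and reset. -/
theorem nextOffset_runs {s : Store} {K j : ℕ} (hK : 0 < K) (hK' : s.int vK 0 = K)
    (hoff : s.int vOff 0 = j % 4 * K) :
    Runs nextOffset s 40 fun s' => s'.int vOff 0 = (j + 1) % 4 * K := by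
  refine Runs.run_of rfl (by decide) ?_
  have hj : j % 4 = 0 ∨ j % 4 = 1 ∨ j % 4 = 2 ∨ j % 4 = 3 := by omega
  have key : (nextOffset.run s).int vOff 0 =
      if K + K + (K + K) ≤ j % 4 * K + K then 0 else j % 4 * K + K := by
    by_cases h : K + K + (K + K) ≤ j % 4 * K + K
    · simp [nextOffset, Test.Holds, hK', hoff, h]
    · simp [nextOffset, Test.Holds, hK', hoff, h]
  rw [key]
  rcases hj with h | h | h | h
  · rw [h, if_neg (by omega), show (j + 1) % 4 = 1 by omega]
    omega
  · rw [h, if_neg (by omega), show (j + 1) % 4 = 2 by omega]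
    omega
  · rw [h, if_neg (by omega), show (j + 1) % 4 = 3 by omega]
    omega
  · rw [h, if_pos (by omega), show (j + 1) % 4 = 0 by omega]
    omega

theorem written_current {B : StripTask} {s : Store} {Y : ℕ → ℝ} {A : ℕ → Finset ℕ} {j : ℕ}
    {out : ℕ → ℕ} : (B.current s).Written Y A j out ↔ B.Written Y A j out :=
  ⟨fun h => ⟨fun i hi => ⟨(h.1 i hi).1, (h.1 i hi).2, (h.1 i hi).3⟩, h.2, h.3⟩,
    fun h => ⟨fun i hi => ⟨(h.1 i hi).1, (h.1 i hi).2, (h.1 i hi).3⟩, h.2, h.3⟩⟩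

/-- Processes a strip and selects the next one. -/
def processStrip : Program :=
  .seq (.setVar vStamp (.add (.var vStamp) (.const 1)))
    (.seq search (.seq writeOutput (.seq markPoints (.seq nextOffset select))))

theorem processStrip_runs {B : StripTask} {Y : ℕ → ℝ} {A : ℕ → Finset ℕ} {j : ℕ} {s : Store}
    (hK : 0 < B.K) {G : Finset ℕ} (hG : B.Cover G) (h : B.Progress Y A j s)
    (hf : 0 < s.int vFound 0) :
    Runs processStrip s
      (2300 * (B.m + 1) ^ (4 * B.K) * ((B.m * B.K + 1) * (B.m * B.K + B.n + 1)))
      fun s' => ∃ Y' A', B.Progress Y' A' (j + 1) s' := by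
  obtain ⟨F, hF⟩ := hG.exists_solution h.selected.le
  have hstrips := h.strips_succ hf
  refine (Runs.seq_of (Runs.of_loopFree rfl s) fun s₁ hs₁ hrun₁ => Runs.seq_of
    (search_runs (h.held.of_sameOff hs₁ rfl) (c := j + 1)
      (by rw [hs₁.int _ rfl]; exact fun p hp => Iff.rfl) (by subst hrun₁; simp [h.stamp])
      (by rw [hs₁.int _ rfl]; exact fun κ => Nat.lt_succ_iff.2 (h.vis_le κ)) hF)
    fun s₂ hs₂ ⟨hvis, C, hC, hset⟩ => Runs.seq_of
    (writeOutput_runs ((h.held.of_sameOff hs₁ rfl).of_sameOff hs₂ rfl) (Y := Y) (A := A) (C := C)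
      (j := j) (by rw [hs₂.int _ rfl, hs₁.int _ rfl]; exact written_current.2 h.written)
      hC.toIndependent hset (by rw [hs₂.int _ rfl, hs₁.int _ rfl, h.off]; rfl))
    fun s₃ hs₃ hout => Runs.seq_of
    (markPoints_runs (B := B) (((h.held.current_of_sameOff hs₁ rfl).current_of_sameOff hs₂
      rfl).current_of_sameOff hs₃ rfl))
    fun s₄ hs₄ hmark => Runs.seq_of
    (nextOffset_runs (j := j) hK
      (by rw [hs₄.int _ rfl, hs₃.int _ rfl, hs₂.int _ rfl, hs₁.int _ rfl, h.K])
      (by rw [hs₄.int _ rfl, hs₃.int _ rfl, hs₂.int _ rfl, hs₁.int _ rfl, h.off]))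
    fun s₅ hs₅ hoff => (select_runs (B := B)
      (by rw [hs₅.int _ rfl, hs₄.int _ rfl, hs₃.int _ rfl, hs₂.int _ rfl, hs₁.int _ rfl]
          exact h.held.n)
      (by rw [hs₅.real _ rfl, hs₄.real _ rfl, hs₃.real _ rfl, hs₂.real _ rfl, hs₁.real _ rfl]
          exact h.held.py)).mono le_rfl
      (Q' := fun s' => ∃ Y' A', B.Progress Y' A' (j + 1) s')
    fun s₆ hs₆ hsel => ⟨Function.update Y j (s.real 4 0), Function.update A j C, ?_⟩).mono
    ?_ fun _ _ h => h
  · have hdone₃ : s₃.int aDone = s.int aDone := by rw [hs₃.int _ rfl, hs₂.int _ rfl, hs₁.int _ rfl]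
    have hy₃ : s₃.real 4 = s.real 4 := by rw [hs₃.real _ rfl, hs₂.real _ rfl, hs₁.real _ rfl]
    have hdone₆ : s₆.int aDone = s₄.int aDone := by rw [hs₆.int _ rfl, hs₅.int _ rfl]
    rw [hdone₃, hy₃, ← hdone₆] at hmark
    refine ⟨?_, hsel, hstrips, ?_, ?_, ?_, ?_, ?_, ?_, ?_⟩
    · exact (((((h.held.current_of_sameOff hs₁ rfl).current_of_sameOff hs₂
        rfl).current_of_sameOff hs₃ rfl).current_of_sameOff hs₄ rfl).current_of_sameOff hs₅
        rfl).current_of_sameOff hs₆ rfl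
    · rw [hs₆.int _ rfl, hs₅.int _ rfl, hs₄.int _ rfl]
      exact written_current.1 hout
    · intro p hp hd i hi
      obtain ⟨h1, h2⟩ := (hmark p hp).1 hd
      push_cast
      rcases Nat.lt_succ_iff_lt_or_eq.1 hi with hi | rfl
      · have h3 := hstrips.gap j (by omega) i hi
        rw [Function.update_self] at h3
        linarith
      · rw [Function.update_self]
        linarith
    · intro p hp hd
      by_cases h1 : s.int aDone p = 0
      · have h2 : B.py p < s.real 4 0 + 7 / 5 := by
          by_contra h2
          exact hd ((hmark p hp).2 ⟨h1, not_lt.1 h2⟩)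
        obtain ⟨e, he, hep⟩ := hC.covered p hp ⟨h1, h2⟩
        exact ⟨j, by omega, e, by rwa [Function.update_self], hep⟩
      · obtain ⟨i, hi, e, he, hep⟩ := h.done p hp h1
        exact ⟨i, by omega, e, by rwa [Function.update_of_ne hi.ne], hep⟩
    · rw [hs₆.int _ rfl, hs₅.int _ rfl, hs₄.int _ rfl, hs₃.int _ rfl, hs₂.int _ rfl, hs₁.int _ rfl,
        h.K]
    · rw [hs₆.int _ rfl, hoff]
    · rw [hs₆.int _ rfl, hs₅.int _ rfl, hs₄.int _ rfl, hs₃.int _ rfl, hs₂.int _ rfl, hrun₁]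
      simp [h.stamp]
    · rw [hs₆.int _ rfl, hs₅.int _ rfl, hs₄.int _ rfl, hs₃.int _ rfl]
      exact hvis
  · change _ + (2000 * (B.m + 1) ^ (4 * B.K) * ((B.m * B.K + 1) * (B.m * B.K + B.n + 1)) +
      (60 * (B.m * B.K + 1) + _)) ≤ _
    have hN : 1 ≤ (B.m + 1) ^ (4 * B.K) := Nat.one_le_pow _ _ (by omega)
    have h1 : B.m * B.K + B.n + 1 ≤ (B.m * B.K + 1) * (B.m * B.K + B.n + 1) :=
      Nat.le_mul_of_pos_left _ (by omega)
    have h2 : (B.m * B.K + 1) * (B.m * B.K + B.n + 1) ≤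
        (B.m + 1) ^ (4 * B.K) * ((B.m * B.K + 1) * (B.m * B.K + B.n + 1)) :=
      Nat.le_mul_of_pos_left _ (by omega)
    rw [mul_assoc 2000, mul_assoc 2300]
    generalize (B.m + 1) ^ (4 * B.K) * ((B.m * B.K + 1) * (B.m * B.K + B.n + 1)) = X at *
    simp only [Program.maxCost, IntExp.cost]
    omega

/-- Computes the minimum of the number of colours and of the number of disks, and makes the list
of the items. -/
def setup : Program :=
  .seq (.seq (.ifElse (.intLe (.get 0 (.const 1)) (.get 0 (.const 2)))
      (.setVar vK (.get 0 (.const 1))) (.setVar vK (.get 0 (.const 2)))) (.setVar vPow (.const 1)))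
    (.forLoop vC (.var vK) (.forLoop vE (.get 0 (.const 1))
      (.seq (.setInt aDisk (.var vM) (.var vE))
        (.seq (.setInt aCol (.var vM) (.var vC))
          (.seq (.setInt aPow (.var vM) (.var vPow))
            (.seq (.setVar vPow (.add (.var vPow) (.var vPow)))
              (.setVar vM (.add (.var vM) (.const 1)))))))))

/-- The memory holds the first `M` items of the list. -/
structure Listed (m M : ℕ) (s : Store) : Prop where
  count : s.int vM 0 = M
  next : s.int vPow 0 = 2 ^ M
  disk : ∀ e < M, s.int aDisk e = e % m
  col : ∀ e < M, s.int aCol e = e / m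
  pow : ∀ e < M, s.int aPow e = 2 ^ e

theorem Listed.congr {m M : ℕ} {s s' : Store} (h : Listed m M s)
    (hs : ∀ a ∈ [vM, vPow, aDisk, aCol, aPow], s'.int a = s.int a) : Listed m M s' := by
  obtain ⟨h1, h2, h3, h4, h5⟩ := h
  simp only [List.mem_cons, List.not_mem_nil, or_false, forall_eq_or_imp, forall_eq] at hs
  obtain ⟨g1, g2, g3, g4, g5⟩ := hs
  exact ⟨by rwa [g1], by rwa [g2], by rwa [g3], by rwa [g4], by rwa [g5]⟩

/-- Two nested counters produce quotient and remainder of the item number without division, and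
doubling produces the powers of 2. -/
theorem setup_runs {s : Store} {m k : ℕ} (hm : s.int 0 1 = m) (hk : s.int 0 2 = k)
    (hM : s.int vM 0 = 0) :
    Runs setup s (100 * (m * min k m + 1)) fun s' =>
      s'.int vK 0 = min k m ∧ Listed m (m * min k m) s' := by
  have hstart : Runs (.seq (.ifElse (.intLe (.get 0 (.const 1)) (.get 0 (.const 2)))
      (.setVar vK (.get 0 (.const 1))) (.setVar vK (.get 0 (.const 2)))) (.setVar vPow (.const 1)))
      s 20 fun s' => s'.int vK 0 = min k m ∧ s'.int vPow 0 = 1 := by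
    refine Runs.run_of rfl (by decide) ?_
    by_cases h : m ≤ k
    · simp [Test.Holds, hm, hk, h]
    · simp [Test.Holds, hm, hk, h, (not_le.1 h).le]
  refine (Runs.seq_of hstart fun s₁ hs₁ ⟨hK, hP⟩ => (Runs.forLoop (min k m) (m * 45 + 15)
    (fun c s' => Listed m (c * m) s') ?_ rfl ?_ ?_).mono le_rfl (Q' := fun s' =>
      s'.int vK 0 = min k m ∧ Listed m (m * min k m) s') ?_).mono ?_ fun _ _ h => h
  · intro s' hs'
    change s'.int vK 0 = _
    rw [hs'.int _ rfl, hK]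
  · have hM₁ : s₁.int vM 0 = 0 := by rw [hs₁.int _ rfl, hM]
    rw [zero_mul]
    exact ⟨by simp [hM₁], by simp [hP], by simp, by simp, by simp⟩
  · rintro c s' hc hs' hv hl
    refine (Runs.forLoop m 28 (fun d s'' => Listed m (c * m + d) s'') ?_ rfl
      (hl.congr (by simp)) ?_).mono ?_ ?_
    · intro s'' hs''
      change s''.int 0 1 = _
      rw [hs''.int _ rfl, hs'.int _ rfl, hs₁.int _ rfl, hm]
    · rintro d s'' hd hs'' hvd ⟨h1, h2, h3, h4, h5⟩
      have hvc : s''.int vC 0 = c := by rw [hs''.int _ rfl, hv]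
      have hmod : (c * m + d) % m = d := by
        rw [add_comm, Nat.add_mul_mod_self_right, Nat.mod_eq_of_lt hd]
      have hdiv : (c * m + d) / m = c := by
        rw [add_comm, Nat.add_mul_div_right _ _ (by omega), Nat.div_eq_of_lt hd, zero_add]
      have hcase : ∀ e < c * m + (d + 1), e < c * m + d ∨ e = c * m + d := fun e he => by omega
      refine Runs.run_of rfl (by decide) ⟨?_, ?_, ?_, ?_, ?_⟩
      · simp [h1, add_assoc]
      · simp [h2, ← add_assoc, pow_succ, mul_two]
      · intro e he
        rcases hcase e he with he | rfl
        · simpa [h1, he.ne] using h3 e he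
        · simp [h1, hvd, hmod]
      · intro e he
        rcases hcase e he with he | rfl
        · simpa [h1, he.ne] using h4 e he
        · simp [h1, hvc, hdiv]
      · intro e he
        rcases hcase e he with he | rfl
        · simpa [h1, he.ne] using h5 e he
        · simp [h1, h2]
    · simp only [IntExp.cost]
      omega
    · intro s'' _ hl'
      rw [Nat.succ_mul]
      exact hl'.congr (by simp)
  · intro s' hs' hl
    refine ⟨by rw [hs'.int _ rfl, hK], ?_⟩
    rwa [mul_comm]
  · simp only [IntExp.cost]
    have h1 : min k m ≤ m * min k m := by
      rcases Nat.eq_zero_or_pos m with rfl | hm0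
      · simp
      · exact Nat.le_mul_of_pos_left _ hm0
    generalize min k m = K at *
    nlinarith

/-- The approximation algorithm. -/
def main : Program :=
  .seq setup (.seq select (.loop (positive (.var vFound)) processStrip))

theorem main_runs {B : StripTask} {s : Store} {k : ℕ} (hBK : B.K = min k B.m) (hK : 0 < B.K)
    (hn : 0 < B.n)
    (h0 : s.int 0 0 = B.n) (h1 : s.int 0 1 = B.m) (h2 : s.int 0 2 = k)
    (hz : ∀ a ≠ 0, ∀ i, s.int a i = 0)
    (hpx : s.real 0 = B.px) (hpy : s.real 1 = B.py) (hdx : s.real 2 = B.dx) (hdy : s.real 3 = B.dy)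
    {G : Finset ℕ} (hG : B.Cover G) :
    Runs main s (3000 * (min B.n (2 * B.m) *
      ((B.m + 1) ^ (4 * B.K) * ((B.m * B.K + 1) * (B.m * B.K + B.n + 1)))))
      fun s' => ∃ Y A j, B.Strips Y j ∧ B.Written Y A j (s'.int 1) ∧
        ∀ p < B.n, ∃ i < j, ∃ e ∈ A i, B.Covers e p := by
  refine (Runs.seq_of (setup_runs h1 h2 (hz _ (by simp) _)) fun s₁ hs₁ ⟨hvK, hl⟩ => Runs.seq_of
    (select_runs (B := B) (by rw [hs₁.int _ rfl, h0]) (by rw [hs₁.real _ rfl, hpy]))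
    fun s₂ hs₂ hsel => (Runs.loop (fun j s' => ∃ Y A, B.Progress Y A j s') (min B.n (2 * B.m))
      (2300 * (B.m + 1) ^ (4 * B.K) * ((B.m * B.K + 1) * (B.m * B.K + B.n + 1))) ?_ ?_).mono le_rfl
      (Q' := fun s' => ∃ Y A j, B.Strips Y j ∧ B.Written Y A j (s'.int 1) ∧
        ∀ p < B.n, ∃ i < j, ∃ e ∈ A i, B.Covers e p) ?_).mono ?_ fun _ _ h => h
  · rw [← hBK] at hl hvK
    have hzero : ∀ a, setup.writesInt a = false → select.writesInt a = false → a ≠ 0 →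
        ∀ i, s₂.int a i = 0 := by
      intro a ha ha' ha0 i
      rw [hs₂.int _ ha', hs₁.int _ ha, hz a ha0]
    have hl₂ : Listed B.m (B.m * B.K) s₂ :=
      hl.congr fun a ha => hs₂.int _ (by fin_cases ha <;> rfl)
    refine ⟨fun _ => 0, fun _ => ∅, ⟨by rw [hs₂.int _ rfl, hs₁.int _ rfl]; exact h0, hl₂.count, hl₂.disk,
      hl₂.col, hl₂.pow, by rw [hs₂.real _ rfl, hs₁.real _ rfl]; exact hpx,
      by rw [hs₂.real _ rfl, hs₁.real _ rfl]; exact hpy,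
      by rw [hs₂.real _ rfl, hs₁.real _ rfl]; exact hdx,
      by rw [hs₂.real _ rfl, hs₁.real _ rfl]; exact hdy, rfl⟩, hsel, ⟨by simp, by simp⟩,
      ⟨by simp, by simp, ?_⟩, by simp, ?_, by rw [hs₂.int _ rfl, hvK], ?_, ?_, ?_⟩
    · intro d _ hd
      rw [hzero 1 rfl rfl (by simp)] at hd
      exact absurd hd (lt_irrefl _)
    · intro p _ hp
      exact absurd (hzero aDone rfl rfl (by simp) p) hp
    · rw [hzero vOff rfl rfl (by simp)]
      simp
    · rw [hzero vStamp rfl rfl (by simp)]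
    · intro κ
      rw [hzero aVis rfl rfl (by simp)]
  · rintro j s' - ⟨Y, A, hP⟩ hf
    -- An unmarked point starts one more strip, so the bounds on `j + 1` strips give the strict
    -- bound on `j`.
    have hst := hP.strips_succ hf
    refine ⟨?_, processStrip_runs hK hG hP hf⟩
    have := hst.le_n
    have := hst.le_m hG
    omega
  · rintro s' - ⟨j, ⟨Y, A, hP⟩, hf⟩
    refine ⟨Y, A, j, hP.strips, hP.written, fun p hp => hP.done p hp fun hd => hf ?_⟩
    exact hP.selected.found.2 ⟨p, hp, hd⟩
  · rw [hBK] at hK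
    have hm : 0 < B.m := by omega
    have hN : 1 ≤ (B.m + 1) ^ (4 * B.K) := Nat.one_le_pow _ _ (by omega)
    have g1 : B.m * B.K + B.n + 1 ≤ (B.m * B.K + 1) * (B.m * B.K + B.n + 1) :=
      Nat.le_mul_of_pos_left _ (by omega)
    have g2 : (B.m * B.K + 1) * (B.m * B.K + B.n + 1) ≤
        (B.m + 1) ^ (4 * B.K) * ((B.m * B.K + 1) * (B.m * B.K + B.n + 1)) :=
      Nat.le_mul_of_pos_left _ (by omega)
    rw [mul_assoc 2300, ← hBK]
    generalize (B.m + 1) ^ (4 * B.K) * ((B.m * B.K + 1) * (B.m * B.K + B.n + 1)) = X at *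
    have g3 : 1 ≤ min B.n (2 * B.m) := by omega
    generalize min B.n (2 * B.m) = N at *
    simp only [Test.cost, IntExp.cost]
    have g4 : X ≤ N * X := Nat.le_mul_of_pos_left _ g3
    have g5 : N ≤ N * X := Nat.le_mul_of_pos_right _ (by omega)
    have g6 : N * (1 + (1 + 1) + 1 + 2300 * X) = 4 * N + 2300 * (N * X) := by ring
    rw [g6]
    omega

end CoverProgram

/-! ### The main theorem -/

theorem mem_unitDisk_iff {p c : Plane} :
    p ∈ unitDisk c ↔ (p 0 - c 0) * (p 0 - c 0) + (p 1 - c 1) * (p 1 - c 1) ≤ 1 := by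
  rw [unitDisk, Metric.mem_closedBall, EuclideanSpace.dist_eq, Real.sqrt_le_one, Fin.sum_univ_two,
    Real.dist_eq, Real.dist_eq, sq_abs, sq_abs, sq, sq]

theorem unitDisk_inter_nonempty_iff {a b : Plane} :
    (unitDisk a ∩ unitDisk b).Nonempty ↔
      (a 0 - b 0) * (a 0 - b 0) + (a 1 - b 1) * (a 1 - b 1) ≤ 4 := by
  have hdist : dist a b ≤ 2 ↔ (a 0 - b 0) * (a 0 - b 0) + (a 1 - b 1) * (a 1 - b 1) ≤ 4 := by
    rw [EuclideanSpace.dist_eq, Real.sqrt_le_left zero_le_two, Fin.sum_univ_two, Real.dist_eq,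
      Real.dist_eq, sq_abs, sq_abs, sq, sq]
    norm_num
  rw [← hdist]
  constructor
  · rintro ⟨z, hz, hz'⟩
    rw [unitDisk, Metric.mem_closedBall] at hz hz'
    linarith [dist_triangle_left a b z]
  · intro h
    refine ⟨midpoint ℝ a b, ?_, ?_⟩
    · rw [unitDisk, Metric.mem_closedBall, dist_midpoint_left, Real.norm_ofNat]
      linarith
    · rw [unitDisk, Metric.mem_closedBall, dist_midpoint_right, Real.norm_ofNat]
      linarith

section Instance

variable {n m : ℕ} (P : Fin n → Plane) (D : Fin m → Plane) (k : ℕ)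

/-- The task of covering the points of an instance. -/
noncomputable def instanceTask : StripTask where
  n := n
  m := m
  K := min k m
  px := (inputStore P D k).real 0
  py := (inputStore P D k).real 1
  dx := (inputStore P D k).real 2
  dy := (inputStore P D k).real 3
  y₀ := 0
  need := fun _ => True

variable {P D k}

theorem instanceTask_covers {e p : ℕ} (hp : p < n) {d : Fin m} (hd : e % m = d) :
    (instanceTask P D k).Covers e p ↔ P ⟨p, hp⟩ ∈ unitDisk (D d) := by
  rw [mem_unitDisk_iff]
  simp [StripTask.Covers, StripTask.x, StripTask.y, instanceTask, inputStore, hp, hd]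

theorem instanceTask_conflict {e e' : ℕ} {d d' : Fin m} (hd : e % m = d) (hd' : e' % m = d') :
    (instanceTask P D k).Conflict e e' ↔
      e / m = e' / m ∧ (unitDisk (D d) ∩ unitDisk (D d')).Nonempty := by
  rw [unitDisk_inter_nonempty_iff]
  simp [StripTask.Conflict, StripTask.x, StripTask.y, instanceTask, inputStore, hd, hd']

/-- If `m ≤ k`, every disk gets its own colour; otherwise the given colours are shifted to begin at
0. So `min k m` colours always suffice. -/
theorem HasColorableCover.exists_cover (h : HasColorableCover P D k) :
    ∃ G, (instanceTask P D k).Cover G := by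
  classical
  obtain ⟨S, χ, hcov, hcol, hprop⟩ := h
  obtain ⟨c, hc, hc'⟩ : ∃ c : Fin m → ℕ, (∀ d ∈ S, c d < min k m) ∧ ∀ d ∈ S, ∀ d' ∈ S, d ≠ d' →
      (unitDisk (D d) ∩ unitDisk (D d')).Nonempty → c d ≠ c d' := by
    rcases le_total m k with hmk | hmk
    · exact ⟨fun d => d, fun d _ => by simp [hmk],
        fun d _ d' _ hne _ heq => hne (Fin.ext heq)⟩
    · refine ⟨fun d => χ d - 1, fun d hd => ?_, fun d hd d' hd' hne hint heq => ?_⟩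
      · have := Finset.mem_Icc.1 (hcol d hd)
        simp only [min_eq_left hmk]
        omega
      · have h1 := Finset.mem_Icc.1 (hcol d hd)
        have h2 := Finset.mem_Icc.1 (hcol d' hd')
        exact hprop d hd d' hd' hne hint (by simp only at heq; omega)
  have hmod (d : Fin m) : (d + m * c d) % m = d := by
    rw [Nat.add_mul_mod_self_left, Nat.mod_eq_of_lt d.2]
  have hdiv (d : Fin m) : (d + m * c d) / m = c d := by
    rw [Nat.add_mul_div_left _ _ d.pos, Nat.div_eq_of_lt d.2, zero_add]
  refine ⟨S.image fun d => d + m * c d, ?_, ?_, ?_⟩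
  · intro e he
    obtain ⟨d, hd, rfl⟩ := Finset.mem_image.1 he
    change _ < m * min k m
    have h1 : m * (c d + 1) ≤ m * min k m := Nat.mul_le_mul_left _ (hc d hd)
    have h2 := d.2
    rw [Nat.mul_succ] at h1
    omega
  · intro e he e' he' hne
    obtain ⟨d, hd, rfl⟩ := Finset.mem_image.1 he
    obtain ⟨d', hd', rfl⟩ := Finset.mem_image.1 he'
    rw [instanceTask_conflict (hmod d) (hmod d'), hdiv, hdiv]
    rintro ⟨heq, hint⟩
    exact hc' d hd d' hd' (by rintro rfl; exact hne rfl) hint heq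
  · intro p hp
    obtain ⟨d, hd, hpd⟩ := hcov ⟨p, hp⟩
    exact ⟨_, Finset.mem_image_of_mem _ hd, (instanceTask_covers hp (hmod d)).2 hpd⟩

/-- Equal output colours mean equal strip numbers mod 4 and equal item colours. In one strip
independence applies; otherwise the strips are at least 4 apart and the centres differ in height by
at least 4 · 7/5 - 17/5 = 11/5 > 2. -/
theorem isColoredCover_of_written {Y : ℕ → ℝ} {A : ℕ → Finset ℕ} {j : ℕ} {s : RealRAM.Store}
    (hY : (instanceTask P D k).Strips Y j) (hA : (instanceTask P D k).Written Y A j (s.int 1))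
    (hcov : ∀ p < n, ∃ i < j, ∃ e ∈ A i, (instanceTask P D k).Covers e p) :
    IsColoredCover P D (4 * k) (outputDisks s m) fun d => outputColor s d := by
  have hmem (d : Fin m) : d ∈ outputDisks s m ↔ 0 < s.int 1 d := by
    rw [outputDisks, Finset.mem_filter, Nat.pos_iff_ne_zero]
    exact and_iff_right (Finset.mem_univ d)
  have hlt : ∀ i < j, ∀ e ∈ A i, e / m < min k m := fun i hi e he =>
    Nat.div_lt_of_lt_mul ((hA.independent i hi).lt e he)
  refine ⟨fun p => ?_, fun d hd => ?_, fun d hd d' hd' hne hint heq => ?_⟩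
  · obtain ⟨i, hi, e, he, hep⟩ := hcov p p.2
    have hm : 0 < m := Nat.pos_of_ne_zero fun h => by
      have := hlt i hi e he
      simp [h] at this
    exact ⟨⟨e % m, Nat.mod_lt _ hm⟩, (hmem _).2 (hA.pos i hi e he),
      (instanceTask_covers p.2 rfl).1 hep⟩
  · rw [hmem] at hd
    obtain ⟨i, hi, e, he, -, hcol⟩ := hA.color d d.2 hd
    have h1 := hlt i hi e he
    have h2 : i % 4 * min k m ≤ 3 * min k m := Nat.mul_le_mul_right _ (by omega)
    change s.int 1 d = i % 4 * min k m + e / m + 1 at hcol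
    rw [Finset.mem_Icc]
    change 1 ≤ s.int 1 d ∧ s.int 1 d ≤ _
    rw [hcol]
    omega
  · rw [hmem] at hd hd'
    obtain ⟨i, hi, e, he, hed, hcol⟩ := hA.color d d.2 hd
    obtain ⟨i', hi', e', he', hed', hcol'⟩ := hA.color d' d'.2 hd'
    change e % m = d at hed
    change e' % m = d' at hed'
    have h1 := hlt i hi e he
    have h2 := hlt i' hi' e' he'
    have heq' : i % 4 * min k m + e / m = i' % 4 * min k m + e' / m := by
      simp only [outputColor, hcol, hcol'] at heq
      exact Nat.succ_injective heq
    have hK : 0 < min k m := (Nat.zero_le _).trans_lt h1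
    have hclass : i % 4 = i' % 4 := by
      have := congrArg (· / min k m) heq'
      simpa [Nat.add_comm, Nat.add_mul_div_right _ _ hK, Nat.div_eq_of_lt h1, Nat.div_eq_of_lt h2]
        using this
    have hcolor : e / m = e' / m := by
      rw [hclass] at heq'
      omega
    have hy : ∀ i < j, ∀ e ∈ A i, ∀ i' < j, ∀ e' ∈ A i', i < i' → i % 4 = i' % 4 →
        ¬ (instanceTask P D k).Conflict e e' := by
      intro i hi e he i' hi' e' he' hlt hmod hc
      have h3 : i + 4 ≤ i' := by omega
      have h4 : (i : ℝ) + 4 ≤ i' := by exact_mod_cast h3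
      have h5 := hY.gap i' hi' i hlt
      have h6 : (instanceTask P D k).y e ≤ Y i + 12 / 5 := ((hA.independent i hi).relevant e he).2
      have h7 : Y i' - 1 ≤ (instanceTask P D k).y e' :=
        ((hA.independent i' hi').relevant e' he').1
      have h8 := hc.2
      nlinarith [mul_self_nonneg ((instanceTask P D k).x e - (instanceTask P D k).x e')]
    have hconf : (instanceTask P D k).Conflict e e' :=
      (instanceTask_conflict hed hed').2 ⟨hcolor, hint⟩
    rcases lt_trichotomy i i' with hlt | rfl | hlt
    · exact hy i hi e he i' hi' e' he' hlt hclass hconf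
    · refine (hA.independent i hi).not_conflict e he e' he' ?_ hconf
      rintro rfl
      exact hne (Fin.ext (hed.symm.trans hed'))
    · exact hy i' hi' e' he' i hi e he hlt hclass.symm hconf.symm

end Instance

/-! ### The running time estimate. -/

theorem mul_pow_le_pow {K m : ℕ} (hK : 0 < K) (hKm : K ≤ m) : (m * K) ^ 2 ≤ m ^ (2 * K) := by
  rcases Nat.lt_or_ge K 2 with h | h
  · obtain rfl : K = 1 := by omega
    simp
  · calc (m * K) ^ 2 ≤ (m * m) ^ 2 := Nat.pow_le_pow_left (Nat.mul_le_mul_left _ hKm) _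
      _ = m ^ 4 := by ring
      _ ≤ m ^ (2 * K) := Nat.pow_le_pow_right (by omega) (by omega)

/-- (1 + 1/m)^(4K) ≤ e^(4K/m) ≤ e⁴. Without capping the number of colours at `m` no absolute
constant would do. -/
theorem succ_pow_le_exp_mul {K m : ℕ} (hm : 0 < m) (hKm : K ≤ m) :
    ((m : ℝ) + 1) ^ (4 * K) ≤ Real.exp 4 * (m : ℝ) ^ (4 * K) := by
  have hm' : (0 : ℝ) < m := by exact_mod_cast hm
  have h1 : (m : ℝ) + 1 ≤ Real.exp (1 / m) * m := by
    have := Real.add_one_le_exp (1 / (m : ℝ))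
    calc (m : ℝ) + 1 = (1 / (m : ℝ) + 1) * m := by field_simp; ring
      _ ≤ _ := by gcongr
  calc ((m : ℝ) + 1) ^ (4 * K) ≤ (Real.exp (1 / m) * m) ^ (4 * K) := by gcongr
    _ = Real.exp ((4 * K : ℕ) * (1 / m)) * (m : ℝ) ^ (4 * K) := by rw [mul_pow, Real.exp_nat_mul]
    _ ≤ Real.exp 4 * (m : ℝ) ^ (4 * K) := by
      gcongr
      rw [mul_one_div, div_le_iff₀ hm']
      exact_mod_cast Nat.mul_le_mul_left 4 hKm

/-- Both bounds on the number of strips are used: `n` against the summand `m * K`, and `2 * m`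
against the summand `n`. This keeps the estimate linear in `n`. -/
theorem time_le {n m K k : ℕ} (hn : 0 < n) (hK : 0 < K) (hKm : K ≤ m) (hKk : K ≤ k) :
    ((3000 * (min n (2 * m) * ((m + 1) ^ (4 * K) * ((m * K + 1) * (m * K + n + 1)))) : ℕ) : ℝ) ≤
      24000 * Real.exp 4 * ((m : ℝ) ^ (6 * k) * n) := by
  have hm : 0 < m := by omega
  have h1 : 1 ≤ m * K := Nat.mul_pos hm hK
  have h2 : min n (2 * m) * (m * K + n + 1) ≤ 4 * (m * K) * n := by
    have g1 : min n (2 * m) * (2 * (m * K)) ≤ n * (2 * (m * K)) :=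
      Nat.mul_le_mul_right _ (min_le_left _ _)
    have g2 : min n (2 * m) * n ≤ 2 * (m * K) * n := by
      refine Nat.mul_le_mul_right _ ((min_le_right _ _).trans ?_)
      exact Nat.mul_le_mul_left _ (Nat.le_mul_of_pos_right _ hK)
    calc min n (2 * m) * (m * K + n + 1) ≤ min n (2 * m) * (2 * (m * K) + n) :=
          Nat.mul_le_mul_left _ (by omega)
      _ = min n (2 * m) * (2 * (m * K)) + min n (2 * m) * n := by ring
      _ ≤ n * (2 * (m * K)) + 2 * (m * K) * n := Nat.add_le_add g1 g2
      _ = 4 * (m * K) * n := by ring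
  have h3 : 3000 * (min n (2 * m) * ((m + 1) ^ (4 * K) * ((m * K + 1) * (m * K + n + 1)))) ≤
      24000 * ((m + 1) ^ (4 * K) * (m ^ (2 * K) * n)) := by
    calc 3000 * (min n (2 * m) * ((m + 1) ^ (4 * K) * ((m * K + 1) * (m * K + n + 1))))
        = 3000 * ((m + 1) ^ (4 * K) * ((m * K + 1) * (min n (2 * m) * (m * K + n + 1)))) := by ring
      -- The factors 2 and 4 turn 3000 into 24000.
      _ ≤ 3000 * ((m + 1) ^ (4 * K) * ((2 * (m * K)) * (4 * (m * K) * n))) := by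
        gcongr
        omega
      _ = 24000 * ((m + 1) ^ (4 * K) * ((m * K) ^ 2 * n)) := by ring
      _ ≤ 24000 * ((m + 1) ^ (4 * K) * (m ^ (2 * K) * n)) :=
        Nat.mul_le_mul_left _ (Nat.mul_le_mul_left _
          (Nat.mul_le_mul_right _ (mul_pow_le_pow hK hKm)))
  have hm' : (1 : ℝ) ≤ m := by exact_mod_cast hm
  calc ((3000 * (min n (2 * m) * ((m + 1) ^ (4 * K) * ((m * K + 1) * (m * K + n + 1)))) : ℕ) : ℝ)
      ≤ ((24000 * ((m + 1) ^ (4 * K) * (m ^ (2 * K) * n)) : ℕ) : ℝ) := by exact_mod_cast h3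
    _ = 24000 * (((m : ℝ) + 1) ^ (4 * K) * ((m : ℝ) ^ (2 * K) * n)) := by push_cast; ring
    _ ≤ 24000 * ((Real.exp 4 * (m : ℝ) ^ (4 * K)) * ((m : ℝ) ^ (2 * K) * n)) := by
      gcongr
      exact succ_pow_le_exp_mul hm hKm
    _ = 24000 * Real.exp 4 * ((m : ℝ) ^ (6 * K) * n) := by
      rw [show 6 * K = 4 * K + 2 * K by ring, pow_add]
      ring
    _ ≤ 24000 * Real.exp 4 * ((m : ℝ) ^ (6 * k) * n) := by
      gcongr

theorem main_approximatesWithin {k : ℕ} (hk : 1 ≤ k) :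
    ApproximatesWithin CoverProgram.main 4 k
      fun n m => 24000 * Real.exp 4 * ((m : ℝ) ^ (6 * k) * n) := by
  intro n m P D hn hP
  obtain ⟨G, hG⟩ := hP.exists_cover
  -- There is a point, so the cover contains a disk.
  have hm : 0 < m := by
    obtain ⟨e, he, -⟩ := hG.covers 0 hn
    refine Nat.pos_of_ne_zero fun h => ?_
    have : e < m * min k m := hG.lt e he
    simp [h] at this
  have hK : 0 < min k m := by omega
  obtain ⟨t, s, hexec, ht, Y, A, j, hY, hA, hcov⟩ := CoverProgram.main_runs
    (B := instanceTask P D k) (s := inputStore P D k) (k := k) rfl hK hn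
    (by simp [inputStore, instanceTask]) (by simp [inputStore, instanceTask])
    (by simp [inputStore]) (by simp +contextual [inputStore]) rfl rfl rfl rfl hG
  refine ⟨t, s, hexec, ?_, isColoredCover_of_written hY hA hcov⟩
  exact (Nat.cast_le.2 ht).trans (time_le hn hK (min_le_right _ _) (min_le_left _ _))

theorem mainTheorem2 :
    (∃ (A : RealRAM.Program) (C : ℝ), ∀ k : ℕ, 1 ≤ k →
      ApproximatesWithin A 4 k
        (fun n m => C * ((m : ℝ) ^ (6 * k) * (n : ℝ) * Real.log ((k : ℝ) + 1)))) ∧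
    (∃ (A : RealRAM.Program) (C : ℝ),
      ApproximatesWithin A 4 3 (fun n m => C * ((m : ℝ) ^ 18 * (n : ℝ)))) := by
  refine ⟨⟨CoverProgram.main, 24000 * Real.exp 4 / Real.log 2, fun k hk n m P D hn hP => ?_⟩,
    ⟨CoverProgram.main, 24000 * Real.exp 4, main_approximatesWithin (k := 3) (by norm_num)⟩⟩
  obtain ⟨t, s, hexec, ht, hcover⟩ := main_approximatesWithin hk n m P D hn hP
  refine ⟨t, s, hexec, ht.trans ?_, hcover⟩
  have h2 : 0 < Real.log 2 := Real.log_pos one_lt_two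
  -- The logarithm enters only through its minimum, which is absorbed into the constant.
  have hlog : Real.log 2 ≤ Real.log ((k : ℝ) + 1) := by
    have : (1 : ℝ) ≤ k := by exact_mod_cast hk
    exact Real.log_le_log two_pos (by linarith)
  calc 24000 * Real.exp 4 * ((m : ℝ) ^ (6 * k) * n)
      = 24000 * Real.exp 4 / Real.log 2 * ((m : ℝ) ^ (6 * k) * n * Real.log 2) := by
        field_simp
    _ ≤ 24000 * Real.exp 4 / Real.log 2 * ((m : ℝ) ^ (6 * k) * n * Real.log ((k : ℝ) + 1)) := by
        gcongr
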